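/- Setting. Let $\Omega\subset\mathbb R^2$ be a bounded convex polygonal domain, let $\mathcal A:\overline\Omega\to\mathbb R^{2\times 2}$ be continuous and symmetric with $\xi^T\mathcal A(x)\xi\ge\beta_0\,\xi^T\xi$ for all $x\in\overline\Omega$, $\xi\in\mathbb R^2$ and some constant $\beta_0>0$, and let $q:\overline\Omega\to[0,\infty)$ be continuous. Let $\mathcal T_h$ be a conforming triangulation of $\overline\Omega$ with $h$ the largest diameter of its triangles. It is called quasi-uniform with constant $\rho>0$ if every triangle contains a disc of radius $\rho h$. Let $Z_h$ be the set of its vertices, $Z_h^0=Z_h\cap\Omega$, and let $V_h$ be the space of continuous functions on $\overline\Omega$ that are affine on each triangle and vanish on $\partial\Omega$. The control volume $K_z^*$ of a vertex $z$ is the union, over the triangles $K=zz_1z_2$ with vertex $z$, of the quadrilaterals whose corners are $z$, the midpoint of $zz_1$, the barycenter of $K$ and the midpoint of $zz_2$; $\Psi_z$ is its characteristic function and $I_h^*v=\sum_{z\in Z_h^0}v(z)\Psi_z$. Let $(\cdot,\cdot)$ be the inner product of $L^2(\Omega)$ and, for $u,v\in V_h$, $$a(u,I_h^*v)=-\sum_{z\in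 Z_h^0}v(z)\int_{\partial K_z^*}\mathcal A\nabla u\cdot\boldsymbol n\,ds ,$$ with outer unit normal $\boldsymbol n$. For $0<\alpha<1$, $T>0$, an integer $N\ge1$, $\tau=T/N$ and $t_n=n\tau$, put $$D_\tau^\alpha\varphi^n=\frac{\tau^{-\alpha}}{\Gamma(2-\alpha)}\sum_{k=0}^n\tilde b_k^n\varphi^k\qquad(1\le n\le N),$$ where $b_k=(k+1)^{1-\alpha}-k^{1-\alpha}$, $\tilde b_n^n=1$, $\tilde b_0^n=(n-1)^{1-\alpha}-n^{1-\alpha}$ and $\tilde b_k^n=b_{n-k}-b_{n-k-1}$ for $0<k<n$. Theorem. For every $\rho>0$ there is $h_0>0$, depending only on $\Omega$, $\mathcal A$, $q$ and $\rho$, such that for every triangulation of $\overline\Omega$ that is quasi-uniform with constant $\rho$ and has $h\le h_0$, and for all $0<\alpha<1$, $T>0$ and $N\ge 1$, the following holds. (a) The quadratic form of the (in general nonsymmetric) system matrix is positive definite: for every $w\in V_h$ with $w\ne0$, $$\frac1{\Gamma(2-\alpha)}(w,I_h^*w)+\tau^\alpha a(w,I_h^*w)+\tau^\alpha(qw,I_h^*w)>0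 .$$ (b) For every continuous $f:\overline\Omega\times[0,T]\to\mathbb R$ and every initial value $u_h^0\in V_h$ there are unique $u_h^1,\dots,u_h^N\in V_h$ such that, for $n=1,\dots,N$ and all $v_h\in V_h$, $$(D_\tau^\alpha u_h^n,I_h^*v_h)+a(u_h^n,I_h^*v_h)+(qu_h^n,I_h^*v_h)=(f(\cdot,t_n),I_h^*v_h).$$ -/

import Mathlib

open scoped Matrix RealInnerProductSpace

noncomputable section

namespace FVE

/-- The Euclidean plane. -/
abbrev Plane : Type := EuclideanSpace ℝ (Fin 2)

/-- A bounded convex polygonal domain: the nonempty interior of the convex hull of finitely many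
points of the plane. -/
def IsConvexPolygonalDomain (Ω : Set Plane) : Prop :=
  Ω.Nonempty ∧ ∃ P : Finset Plane, Ω = interior (convexHull ℝ (P : Set Plane))

/-- A conforming triangulation of `Ω`. A triangle is given by its set of three affinely
independent vertices and, as a point set, is the convex hull of these. Two triangles meet exactly
in the convex hull of their common vertices (so in nothing, a common vertex or a common edge),
and the triangles cover the closure of `Ω`. -/
structure Triangulation (Ω : Set Plane) where
  /-- the triangles, given by their vertices -/
  triangles : Finset (Finset Plane)
  card_eq : ∀ K ∈ triangles, K.card = 3
  indep : ∀ K ∈ triangles, AffineIndependent ℝ ((↑) : K → Plane)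
  inter_eq : ∀ K ∈ triangles, ∀ L ∈ triangles,
    convexHull ℝ (K : Set Plane) ∩ convexHull ℝ (L : Set Plane) =
      convexHull ℝ ((K : Set Plane) ∩ (L : Set Plane))
  cover : ⋃ K ∈ triangles, convexHull ℝ (K : Set Plane) = closure Ω

/-- The barycenter of a triangle with vertex set `K`. -/
def barycenter (K : Finset Plane) : Plane := (3 : ℝ)⁻¹ • ∑ z ∈ K, z

/-- Rotation of the plane by a right angle. -/
def rot (v : Plane) : Plane := !₂[v 1, -v 0]

/-- For two vertices `z`, `z'` of the triangle `K`, the unit normal to the segment from the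
midpoint of `z z'` to the barycenter of `K` that points from the side of `z` to the side
of `z'`. -/
def unitNormal (K : Finset Plane) (z z' : Plane) : Plane :=
  let d := rot (barycenter K - midpoint ℝ z z')
  (Real.sign ⟪d, z' - z⟫ * ‖d‖⁻¹) • d

namespace Triangulation

variable {Ω : Set Plane} (𝒯 : Triangulation Ω)

/-- The mesh size `h`: the largest diameter of a triangle. -/
def meshSize : ℝ := ⨆ K : 𝒯.triangles, Metric.diam (convexHull ℝ ((K : Finset Plane) : Set Plane))

/-- Quasi-uniformity with constant `ρ`: every triangle contains a disc of radius `ρ h`. -/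
def IsQuasiUniform (ρ : ℝ) : Prop :=
  ∀ K ∈ 𝒯.triangles, ∃ c : Plane,
    Metric.closedBall c (ρ * 𝒯.meshSize) ⊆ convexHull ℝ (K : Set Plane)

/-- The set `Z_h` of all vertices. -/
def vertices : Finset Plane := by
  classical exact 𝒯.triangles.biUnion id

/-- The set `Z_h⁰` of interior vertices. -/
def interiorVertices : Finset Plane := by
  classical exact 𝒯.vertices.filter (fun z => z ∈ Ω)

/-- The triangles that have `z` as a vertex. -/
def trianglesAt (z : Plane) : Finset (Finset Plane) := by
  classical exact 𝒯.triangles.filter (fun K => z ∈ K)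

/-- The control volume of the vertex `z`. In each triangle `K = z z₁ z₂` at `z` it consists of the
quadrilateral with corners `z`, the midpoint of `z z₁`, the barycenter of `K`, and the midpoint of
`z z₂`. (Note that `z = midpoint ℝ z z`.) -/
def controlVolume (z : Plane) : Set Plane :=
  ⋃ K ∈ 𝒯.trianglesAt z,
    convexHull ℝ (insert (barycenter K) (midpoint ℝ z '' (K : Set Plane)))

/-- The trial space `V_h`: continuous functions, affine on each triangle, and zero on the boundary
of `Ω`. Elements are represented by their continuous representative, extended by zero outside
`Ω`. -/
def trialSpace : Submodule ℝ (Plane → ℝ) where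
  carrier := {v | Continuous v ∧ (∀ x ∉ Ω, v x = 0) ∧
    ∀ K ∈ 𝒯.triangles, ∃ g : Plane →ᵃ[ℝ] ℝ, Set.EqOn v g (convexHull ℝ (K : Set Plane))}
  add_mem' := by
    rintro v w ⟨hv, hv0, hvK⟩ ⟨hw, hw0, hwK⟩
    refine ⟨hv.add hw, fun x hx => by simp [hv0 x hx, hw0 x hx], fun K hK => ?_⟩
    obtain ⟨g, hg⟩ := hvK K hK
    obtain ⟨k, hk⟩ := hwK K hK
    exact ⟨g + k, fun x hx => by simp [hg hx, hk hx]⟩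
  zero_mem' := ⟨continuous_zero, fun _ _ => rfl, fun _ _ => ⟨0, fun _ _ => by simp⟩⟩
  smul_mem' := by
    rintro c v ⟨hv, hv0, hvK⟩
    refine ⟨hv.const_smul c, fun x hx => by simp [hv0 x hx], fun K hK => ?_⟩
    obtain ⟨g, hg⟩ := hvK K hK
    exact ⟨c • g, fun x hx => by simp [hg hx]⟩

/-- The interpolation operator `I_h^* v = ∑_{z ∈ Z_h⁰} v(z) Ψ_z`, where `Ψ_z` is the characteristic
function of the control volume of `z`. -/
def dualInterp (v : Plane → ℝ) : Plane → ℝ := fun x =>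
  ∑ z ∈ 𝒯.interiorVertices, v z * (𝒯.controlVolume z).indicator (fun _ => (1 : ℝ)) x

/-- The flux `∫_{∂K_z^*} A ∇u ⋅ n ds` through the boundary of the control volume of `z`, with outer
unit normal `n`. For an interior vertex `z` this boundary consists of the segments, in the
triangles `K` at `z`, from the midpoint of an edge `z z'` of `K` to the barycenter of `K`; each of
them is parametrized over `[0, 1]`. (For a vertex on the boundary of `Ω` only the part of the
boundary of the control volume inside `Ω` is included; functions in the range of `dualInterp`
vanish at such a vertex, so that these fluxes do not enter the bilinear form below.) -/
def flux (A : Plane → Matrix (Fin 2) (Fin 2) ℝ) (u : Plane → ℝ) (z : Plane) : ℝ := by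
  classical exact
  ∑ K ∈ 𝒯.trianglesAt z, ∑ z' ∈ K.erase z,
    ∫ t in (0 : ℝ)..1,
      ((A (AffineMap.lineMap (midpoint ℝ z z') (barycenter K) t) *ᵥ
          (gradient u (AffineMap.lineMap (midpoint ℝ z z') (barycenter K) t)).ofLp) ⬝ᵥ
        (unitNormal K z z').ofLp) *
        ‖barycenter K - midpoint ℝ z z'‖

/-- The bilinear form `a(u, v̄) = -∑_{z ∈ Z_h} v̄(z) ∫_{∂K_z^*} A ∇u ⋅ n ds` for a trial function `u`
and a test function `v̄`. -/
def diffusionForm (A : Plane → Matrix (Fin 2) (Fin 2) ℝ) (u vbar : Plane → ℝ) : ℝ :=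
  -∑ z ∈ 𝒯.vertices, vbar z * 𝒯.flux A u z

end Triangulation

/-- The inner product of `L²(Ω)`. -/
def inner2 (Ω : Set Plane) (φ ψ : Plane → ℝ) : ℝ := ∫ x in Ω, φ x * ψ x

/-- The weights `b_k = (k+1)^{1-α} - k^{1-α}` of the `L1`-formula. -/
def b (α : ℝ) (k : ℕ) : ℝ := ((k : ℝ) + 1) ^ (1 - α) - (k : ℝ) ^ (1 - α)

/-- The weights `b̃_k^n`, for `0 ≤ k ≤ n` and `1 ≤ n`. -/
def btilde (α : ℝ) (n k : ℕ) : ℝ :=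
  if k = n then 1
  else if k = 0 then ((n : ℝ) - 1) ^ (1 - α) - (n : ℝ) ^ (1 - α)
  else b α (n - k) - b α (n - k - 1)

/-- The discrete Caputo derivative
`D_τ^α φ^n = τ^{-α} / Γ(2-α) * ∑_{k=0}^n b̃_k^n φ^k` of the `L1`-formula. -/
def discreteCaputo (α τ : ℝ) {N : ℕ} (φ : Fin (N + 1) → Plane → ℝ) (n : Fin (N + 1)) :
    Plane → ℝ := fun x =>
  τ ^ (-α) / Real.Gamma (2 - α) * ∑ k ∈ Finset.Iic n, btilde α n k * φ k x

namespace Triangulation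

variable {Ω : Set Plane} (𝒯 : Triangulation Ω)

/-- The fully discrete finite volume element scheme on the time grid `t_n = n τ`, `τ = T / N`:
for `n = 1, …, N` and all `v ∈ V_h`,
`(D_τ^α u^n, I_h^* v) + a(u^n, I_h^* v) + (q u^n, I_h^* v) = (f(⋅, t_n), I_h^* v)`. -/
def SolvesScheme (A : Plane → Matrix (Fin 2) (Fin 2) ℝ) (q : Plane → ℝ) (f : Plane → ℝ → ℝ)
    (α T : ℝ) (N : ℕ) (u : Fin (N + 1) → 𝒯.trialSpace) : Prop :=
  ∀ n : Fin (N + 1), n ≠ 0 → ∀ v ∈ 𝒯.trialSpace,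
    inner2 Ω (discreteCaputo α (T / N) (fun k => (u k : Plane → ℝ)) n) (𝒯.dualInterp v)
      + 𝒯.diffusionForm A (u n) (𝒯.dualInterp v)
      + inner2 Ω (fun x => q x * (u n : Plane → ℝ) x) (𝒯.dualInterp v)
    = inner2 Ω (fun x => f x ((n : ℕ) * (T / N))) (𝒯.dualInterp v)

/-- The bilinear form `G(u, v) = Γ(2-α)⁻¹ (u, I_h^* v) + τ^α a(u, I_h^* v) + τ^α (q u, I_h^* v)`.
Its values at pairs of basis functions of `V_h` are the entries of the system matrix that has to be
inverted at each time level. -/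
def systemForm (A : Plane → Matrix (Fin 2) (Fin 2) ℝ) (q : Plane → ℝ) (α τ : ℝ)
    (u v : Plane → ℝ) : ℝ :=
  (Real.Gamma (2 - α))⁻¹ * inner2 Ω u (𝒯.dualInterp v)
    + τ ^ α * 𝒯.diffusionForm A u (𝒯.dualInterp v)
    + τ ^ α * inner2 Ω (fun x => q x * u x) (𝒯.dualInterp v)

end Triangulation

end FVE

end

/-! Everything rests on positive definiteness; solvability then follows by linear algebra and
recursion in time. Write $G$ for the gradient of $w$ on a triangle.

Mass term. Almost everywhere on a triangle, $I_h^*w$ is the nodal value at the vertex with the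
largest barycentric coordinate (`ae_dualInterp_eq_dualValue`). The cyclic permutation of the
vertices is an area-preserving affine map of the triangle, and the integrand summed over an orbit is
pointwise nonnegative. Hence $(w,I_h^*w)\ge0$ (`setIntegral_mul_dualValue_nonneg`).

Diffusion term. Summation by parts turns the form into a sum over edges. For a constant coefficient
$M$ it equals the finite element form $|K|\,G\cdot MG$ (`sum_edgeNormal`). Freezing $\mathcal A$ at
a vertex costs at most $12\varepsilon h^2|G|^2$, where $\varepsilon$ bounds the oscillation of the
entries of $\mathcal A$ (`neg_sum_edgeFlux_ge`). Quasi-uniformity gives $|K|\ge\rho^2h^2/4$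
(`sq_le_of_closedBall_subset`), so for small $h$ ellipticity wins.

Reaction term. The weight $q$ breaks the cyclic symmetry, but $4xy\ge-(x-y)^2$ bounds the negative
part by a multiple of $h^4|G|^2$, which the diffusion term absorbs for small $h$
(`diffusionForm_add_inner2_pos`). The sum of the two is strictly positive: otherwise all gradients
vanish and $w=0$ by continuity. Neither $\alpha$ nor $\tau$ enters this balance, so $h_0$ is
independent of them.

Scheme. Multiplied by $\tau^\alpha$, one time step is a linear equation for the system form, with a
right-hand side determined by earlier levels (`scheme_step_iff`). A positive definite form on a
finite-dimensional space is nondegenerate (`systemBilin_bijective`). -/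

noncomputable section

namespace FVE

open MeasureTheory

/-! ### Barycentric coordinates on a triangle -/

/-- The vertex set of the triangle spanned by an affine basis of the plane. -/
def basisVertices (b : AffineBasis (Fin 3) ℝ Plane) : Finset Plane :=
  Finset.univ.map ⟨b, b.ind.injective⟩

theorem mem_basisVertices {b : AffineBasis (Fin 3) ℝ Plane} {z : Plane} :
    z ∈ basisVertices b ↔ ∃ i, b i = z := by
  simp [basisVertices]

theorem coe_basisVertices (b : AffineBasis (Fin 3) ℝ Plane) :
    (basisVertices b : Set Plane) = Set.range b := by
  ext z; simp [mem_basisVertices]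

theorem sum_basisVertices {M : Type*} [AddCommMonoid M] (b : AffineBasis (Fin 3) ℝ Plane)
    (f : Plane → M) : ∑ z ∈ basisVertices b, f z = f (b 0) + f (b 1) + f (b 2) := by
  simp [basisVertices, Fin.sum_univ_three]

/-- Gives every triangle of the mesh a numbering of its vertices, and with it barycentric
coordinates. -/
theorem exists_basisVertices_eq {K : Finset Plane} (hc : K.card = 3)
    (hi : AffineIndependent ℝ ((↑) : K → Plane)) :
    ∃ b : AffineBasis (Fin 3) ℝ Plane, K = basisVertices b := by
  have e : Fin 3 ≃ K := (finCongr hc.symm).trans K.equivFin.symm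
  have hi' : AffineIndependent ℝ (fun i => (e i : Plane)) := hi.comp_embedding e.toEmbedding
  refine ⟨⟨fun i => (e i : Plane), hi', ?_⟩, ?_⟩
  · rw [hi'.affineSpan_eq_top_iff_card_eq_finrank_add_one]
    simp
  · ext z
    rw [mem_basisVertices]
    constructor
    · intro hz
      exact ⟨e.symm ⟨z, hz⟩, congrArg Subtype.val (e.apply_symm_apply ⟨z, hz⟩)⟩
    · rintro ⟨i, rfl⟩
      exact (e i).2

theorem mem_convexHull_basisVertices {b : AffineBasis (Fin 3) ℝ Plane} {x : Plane} :
    x ∈ convexHull ℝ (basisVertices b : Set Plane) ↔ ∀ i, 0 ≤ b.coord i x := by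
  rw [coe_basisVertices, b.convexHull_eq_nonneg_coord]; rfl

theorem mem_interior_convexHull_basisVertices {b : AffineBasis (Fin 3) ℝ Plane} {x : Plane} :
    x ∈ interior (convexHull ℝ (basisVertices b : Set Plane)) ↔ ∀ i, 0 < b.coord i x := by
  rw [coe_basisVertices, b.interior_convexHull]; rfl

theorem basis_mem_convexHull (b : AffineBasis (Fin 3) ℝ Plane) (i : Fin 3) :
    b i ∈ convexHull ℝ (basisVertices b : Set Plane) :=
  subset_convexHull _ _ (by simp [mem_basisVertices])

theorem isCompact_convexHull_finset (K : Finset Plane) :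
    IsCompact (convexHull ℝ (K : Set Plane)) :=
  K.finite_toSet.isCompact_convexHull (𝕜 := ℝ)

theorem affineMap_eq_linear_add (g : Plane →ᵃ[ℝ] ℝ) (x : Plane) : g x = g.linear x + g 0 := by
  have := congrFun (AffineMap.decomp g) x
  simpa using this

theorem affineMap_smul_add (g : Plane →ᵃ[ℝ] ℝ) (c₀ c₁ c₂ : ℝ) (h : c₀ + c₁ + c₂ = 1)
    (x y z : Plane) : g (c₀ • x + c₁ • y + c₂ • z) = c₀ * g x + c₁ * g y + c₂ * g z := by
  rw [affineMap_eq_linear_add g, affineMap_eq_linear_add g x, affineMap_eq_linear_add g y,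
    affineMap_eq_linear_add g z]
  simp only [map_add, map_smul, smul_eq_mul]
  linear_combination -g 0 * h

theorem sum_coord (b : AffineBasis (Fin 3) ℝ Plane) (x : Plane) :
    b.coord 0 x + b.coord 1 x + b.coord 2 x = 1 := by
  rw [← b.sum_coord_apply_eq_one x, Fin.sum_univ_three]

theorem eq_coord_combination (b : AffineBasis (Fin 3) ℝ Plane) (x : Plane) :
    x = b.coord 0 x • b 0 + b.coord 1 x • b 1 + b.coord 2 x • b 2 := by
  conv_lhs => rw [← b.linear_combination_coord_eq_self x, Fin.sum_univ_three]

theorem affineMap_eq_coord (b : AffineBasis (Fin 3) ℝ Plane) (g : Plane →ᵃ[ℝ] ℝ) (x : Plane) :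
    g x = b.coord 0 x * g (b 0) + b.coord 1 x * g (b 1) + b.coord 2 x * g (b 2) := by
  conv_lhs => rw [eq_coord_combination b x]
  exact affineMap_smul_add g _ _ _ (sum_coord b x) _ _ _

theorem barycenter_basisVertices (b : AffineBasis (Fin 3) ℝ Plane) :
    barycenter (basisVertices b) = (3 : ℝ)⁻¹ • b 0 + (3 : ℝ)⁻¹ • b 1 + (3 : ℝ)⁻¹ • b 2 := by
  rw [barycenter, sum_basisVertices, smul_add, smul_add]

theorem coord_barycenter (b : AffineBasis (Fin 3) ℝ Plane) (i : Fin 3) :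
    b.coord i (barycenter (basisVertices b)) = 3⁻¹ := by
  rw [barycenter_basisVertices, affineMap_smul_add _ _ _ _ (by norm_num)]
  fin_cases i <;> simp [b.coord_apply]

theorem coord_midpoint (b : AffineBasis (Fin 3) ℝ Plane) (i : Fin 3) (x y : Plane) :
    b.coord i (midpoint ℝ x y) = (b.coord i x + b.coord i y) / 2 := by
  rw [AffineMap.map_midpoint, midpoint_eq_smul_add, smul_eq_mul]
  simp; ring

theorem barycenter_mem_convexHull (b : AffineBasis (Fin 3) ℝ Plane) :
    barycenter (basisVertices b) ∈ convexHull ℝ (basisVertices b : Set Plane) := by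
  rw [mem_convexHull_basisVertices]
  intro i; rw [coord_barycenter]; norm_num

theorem midpoint_mem_convexHull (b : AffineBasis (Fin 3) ℝ Plane) (i j : Fin 3) :
    midpoint ℝ (b i) (b j) ∈ convexHull ℝ (basisVertices b : Set Plane) :=
  (convex_convexHull ℝ _).midpoint_mem (basis_mem_convexHull b i) (basis_mem_convexHull b j)

/-- The part of the control volume of a vertex in one triangle is where the barycentric coordinate
of that vertex is the largest. -/
theorem mem_dualQuad_iff {b : AffineBasis (Fin 3) ℝ Plane} {i : Fin 3} {x : Plane} :
    x ∈ convexHull ℝ (insert (barycenter (basisVertices b))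
        (midpoint ℝ (b i) '' (basisVertices b : Set Plane))) ↔
      (∀ j, 0 ≤ b.coord j x) ∧ ∀ j, b.coord j x ≤ b.coord i x := by
  constructor
  · intro hx
    have hconv : Convex ℝ {x : Plane | (∀ j, 0 ≤ b.coord j x) ∧
        ∀ j, b.coord j x ≤ b.coord i x} := by
      intro y hy z hz s t hs ht hst
      have key : ∀ j, b.coord j (s • y + t • z) = s * b.coord j y + t * b.coord j z := by
        intro j
        have := affineMap_smul_add (b.coord j) s t 0 (by linarith) y z 0
        simpa using this
      refine ⟨fun j => ?_, fun j => ?_⟩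
      · rw [key]
        exact add_nonneg (mul_nonneg hs (hy.1 j)) (mul_nonneg ht (hz.1 j))
      · rw [key, key]
        exact add_le_add (mul_le_mul_of_nonneg_left (hy.2 j) hs)
          (mul_le_mul_of_nonneg_left (hz.2 j) ht)
    refine convexHull_min ?_ hconv hx
    rintro y (rfl | ⟨z, hz, rfl⟩)
    · exact ⟨fun j => by rw [coord_barycenter]; norm_num,
        fun j => by rw [coord_barycenter, coord_barycenter]⟩
    · rw [coe_basisVertices] at hz
      obtain ⟨k, rfl⟩ := hz
      refine ⟨fun j => ?_, fun j => ?_⟩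
      · simp only [coord_midpoint, b.coord_apply]
        split_ifs <;> norm_num
      · simp only [coord_midpoint, b.coord_apply]
        split_ifs <;> first | (exfalso; grind) | norm_num
  · rintro ⟨h0, hm⟩
    set S := convexHull ℝ (insert (barycenter (basisVertices b))
        (midpoint ℝ (b i) '' (basisVertices b : Set Plane))) with hS
    have hbar : barycenter (basisVertices b) ∈ S := subset_convexHull _ _ (Set.mem_insert _ _)
    have hmid : ∀ j, midpoint ℝ (b i) (b j) ∈ S := fun j =>
      subset_convexHull _ _ (Set.mem_insert_of_mem _
        ⟨b j, by rw [coe_basisVertices]; exact ⟨j, rfl⟩, rfl⟩)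
    have hcv : Convex ℝ S := convex_convexHull ℝ _
    have comb : ∀ (c₀ c₁ c₂ : ℝ) (p q r : Plane), 0 ≤ c₀ → 0 ≤ c₁ → 0 ≤ c₂ → c₀ + c₁ + c₂ = 1 →
        p ∈ S → q ∈ S → r ∈ S → c₀ • p + c₁ • q + c₂ • r ∈ S := by
      intro c₀ c₁ c₂ p q r h₀ h₁ h₂ hs hp hq hr
      have := hcv.sum_mem (t := Finset.univ) (w := ![c₀, c₁, c₂]) (z := ![p, q, r])
        (by intro k _; fin_cases k <;> simpa) (by simpa [Fin.sum_univ_three] using hs)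
        (by intro k _; fin_cases k <;> simpa)
      simpa [Fin.sum_univ_three] using this
    have main : ∀ j k : Fin 3,
        barycenter (basisVertices b) = (3 : ℝ)⁻¹ • b i + (3 : ℝ)⁻¹ • b j + (3 : ℝ)⁻¹ • b k →
        b.coord i x + b.coord j x + b.coord k x = 1 →
        x = b.coord i x • b i + b.coord j x • b j + b.coord k x • b k →
        b.coord k x ≤ b.coord j x → x ∈ S := by
      intro j k hb hsum hx hkj
      -- For ordered coordinates $\lambda_i\ge\lambda_j\ge\lambda_k$, peel off the barycenter to
      -- remove $b_k$, then the midpoint of $b_ib_j$ to remove $b_j$; a nonnegative multiple of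
      -- $b_i$ remains.
      have := comb (3 * b.coord k x) (2 * (b.coord j x - b.coord k x))
        (b.coord i x - b.coord j x) _ _ _ (by linarith [h0 k]) (by linarith) (by linarith [hm j])
        (by linarith) hbar (hmid j) (hmid i)
      convert this using 1
      rw [hb, midpoint_self, midpoint_eq_smul_add, invOf_eq_inv]
      conv_lhs => rw [hx]
      module
    have hb := barycenter_basisVertices b
    have hs := sum_coord b x
    have hx := eq_coord_combination b x
    obtain rfl | rfl | rfl : i = 0 ∨ i = 1 ∨ i = 2 := by fin_cases i <;> simp
    · rcases le_total (b.coord 1 x) (b.coord 2 x) with h | h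
      · exact main 2 1 (by rw [hb]; abel) (by linarith) (by exact hx.trans (by abel)) h
      · exact main 1 2 hb hs hx h
    · rcases le_total (b.coord 0 x) (b.coord 2 x) with h | h
      · exact main 2 0 (by rw [hb]; abel) (by linarith) (by exact hx.trans (by abel)) h
      · exact main 0 2 (by rw [hb]; abel) (by linarith) (by exact hx.trans (by abel)) h
    · rcases le_total (b.coord 0 x) (b.coord 1 x) with h | h
      · exact main 1 0 (by rw [hb]; abel) (by linarith) (by exact hx.trans (by abel)) h
      · exact main 0 1 (by rw [hb]; abel) (by linarith) (by exact hx.trans (by abel)) h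

/-! ### Gradients of affine functions and fluxes through dual edges -/

/-- The gradient of an affine function on the plane. -/
def gradVec (g : Plane →ᵃ[ℝ] ℝ) : Plane :=
  (InnerProductSpace.toDual ℝ Plane).symm (LinearMap.toContinuousLinearMap g.linear)

theorem inner_gradVec (g : Plane →ᵃ[ℝ] ℝ) (v : Plane) : ⟪gradVec g, v⟫ = g.linear v := by
  simp [gradVec]

theorem affineMap_sub (g : Plane →ᵃ[ℝ] ℝ) (x y : Plane) : g y - g x = ⟪gradVec g, y - x⟫ := by
  rw [inner_gradVec, map_sub, affineMap_eq_linear_add g y, affineMap_eq_linear_add g x]; ring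

theorem hasGradientAt_affineMap (g : Plane →ᵃ[ℝ] ℝ) (x : Plane) :
    HasGradientAt g (gradVec g) x := by
  rw [hasGradientAt_iff_hasFDerivAt]
  simp only [gradVec, LinearIsometryEquiv.apply_symm_apply]
  have h := (LinearMap.toContinuousLinearMap g.linear).hasFDerivAt (x := x) |>.add_const (g 0)
  refine h.congr_of_eventuallyEq (Filter.Eventually.of_forall fun y => ?_)
  simp [affineMap_eq_linear_add g y]

theorem hasGradientAt_of_eqOn {u : Plane → ℝ} {g : Plane →ᵃ[ℝ] ℝ} {s : Set Plane}
    (h : Set.EqOn u g s) {x : Plane} (hx : x ∈ interior s) : HasGradientAt u (gradVec g) x :=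
  (hasGradientAt_affineMap g x).congr_of_eventuallyEq
    (h.eventuallyEq_of_mem (mem_interior_iff_mem_nhds.mp hx))

/-- The flux through the segment from the midpoint of the edge `z z'` to the barycenter. -/
def edgeFlux (A : Plane → Matrix (Fin 2) (Fin 2) ℝ) (u : Plane → ℝ) (K : Finset Plane)
    (z z' : Plane) : ℝ :=
  ∫ t in (0 : ℝ)..1,
    ((A (AffineMap.lineMap (midpoint ℝ z z') (barycenter K) t) *ᵥ
        (gradient u (AffineMap.lineMap (midpoint ℝ z z') (barycenter K) t)).ofLp) ⬝ᵥ
      (unitNormal K z z').ofLp) * ‖barycenter K - midpoint ℝ z z'‖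

/-- The normal to the segment from the midpoint of the edge `z z'` to the barycenter, scaled by
the length of the segment. -/
def edgeNormal (K : Finset Plane) (z z' : Plane) : Plane :=
  Real.sign ⟪rot (barycenter K - midpoint ℝ z z'), z' - z⟫ • rot (barycenter K - midpoint ℝ z z')

theorem norm_rot (v : Plane) : ‖rot v‖ = ‖v‖ := by
  simp [EuclideanSpace.norm_eq, rot, Fin.sum_univ_two, add_comm]

theorem norm_smul_unitNormal (K : Finset Plane) (z z' : Plane) :
    ‖barycenter K - midpoint ℝ z z'‖ • unitNormal K z z' = edgeNormal K z z' := by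
  simp only [unitNormal, edgeNormal, smul_smul, norm_rot]
  rcases eq_or_ne (barycenter K - midpoint ℝ z z') 0 with h | h
  · have : rot (0 : Plane) = 0 := by
      rw [← norm_eq_zero, norm_rot, norm_zero]
    rw [h, this]; simp
  · congr 1
    field_simp

theorem norm_edgeNormal_le (K : Finset Plane) (z z' : Plane) :
    ‖edgeNormal K z z'‖ ≤ ‖barycenter K - midpoint ℝ z z'‖ := by
  rw [edgeNormal, norm_smul, norm_rot]
  refine mul_le_of_le_one_left (norm_nonneg _) ?_
  rcases Real.sign_apply_eq ⟪rot (barycenter K - midpoint ℝ z z'), z' - z⟫ with h | h | h <;>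
    simp [h]

theorem edgeNormal_swap (K : Finset Plane) (z z' : Plane) :
    edgeNormal K z' z = -edgeNormal K z z' := by
  rw [edgeNormal, edgeNormal, midpoint_comm, ← neg_smul, ← Real.sign_neg, ← inner_neg_right,
    neg_sub]

theorem mulVec_dotProduct_eq (M : Matrix (Fin 2) (Fin 2) ℝ) (v w : Fin 2 → ℝ) :
    (M *ᵥ v) ⬝ᵥ w = (M 0 0 * v 0 + M 0 1 * v 1) * w 0 + (M 1 0 * v 0 + M 1 1 * v 1) * w 1 := by
  simp [Matrix.mulVec, dotProduct, Fin.sum_univ_two]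

theorem lineMap_mem_interior (b : AffineBasis (Fin 3) ℝ Plane) (i j : Fin 3) {t : ℝ}
    (ht0 : 0 < t) (ht1 : t ≤ 1) :
    AffineMap.lineMap (midpoint ℝ (b i) (b j)) (barycenter (basisVertices b)) t ∈
      interior (convexHull ℝ (basisVertices b : Set Plane)) := by
  rw [mem_interior_convexHull_basisVertices]
  intro k
  rw [AffineMap.apply_lineMap, coord_barycenter, AffineMap.lineMap_apply]
  have := mem_convexHull_basisVertices.mp (midpoint_mem_convexHull b i j) k
  simp only [vsub_eq_sub, smul_eq_mul, vadd_eq_add]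
  nlinarith

theorem lineMap_mem_convexHull (b : AffineBasis (Fin 3) ℝ Plane) (i j : Fin 3) {t : ℝ}
    (ht : t ∈ Set.Icc (0 : ℝ) 1) :
    AffineMap.lineMap (midpoint ℝ (b i) (b j)) (barycenter (basisVertices b)) t ∈
      convexHull ℝ (basisVertices b : Set Plane) :=
  (convex_convexHull ℝ _).lineMap_mem (midpoint_mem_convexHull b i j)
    (barycenter_mem_convexHull b) ht

theorem edgeFlux_eq (A : Plane → Matrix (Fin 2) (Fin 2) ℝ) {u : Plane → ℝ}
    {b : AffineBasis (Fin 3) ℝ Plane} {g : Plane →ᵃ[ℝ] ℝ}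
    (h : Set.EqOn u g (convexHull ℝ (basisVertices b : Set Plane))) (i j : Fin 3) :
    edgeFlux A u (basisVertices b) (b i) (b j) =
      ∫ t in (0 : ℝ)..1,
        (A (AffineMap.lineMap (midpoint ℝ (b i) (b j)) (barycenter (basisVertices b)) t) *ᵥ
          (gradVec g).ofLp) ⬝ᵥ (edgeNormal (basisVertices b) (b i) (b j)).ofLp := by
  refine intervalIntegral.integral_congr_ae (Filter.Eventually.of_forall fun t ht => ?_)
  -- At $t=0$ the point lies on an edge, where `u` need not be differentiable; the half-open
  -- interval excludes it.
  rw [Set.uIoc_of_le zero_le_one] at ht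
  rw [(hasGradientAt_of_eqOn h (lineMap_mem_interior b i j ht.1 ht.2)).gradient,
    ← norm_smul_unitNormal]
  simp only [WithLp.ofLp_smul, dotProduct_smul, smul_eq_mul]
  ring

theorem edgeFlux_swap (A : Plane → Matrix (Fin 2) (Fin 2) ℝ) {u : Plane → ℝ}
    {b : AffineBasis (Fin 3) ℝ Plane} {g : Plane →ᵃ[ℝ] ℝ}
    (h : Set.EqOn u g (convexHull ℝ (basisVertices b : Set Plane))) (i j : Fin 3) :
    edgeFlux A u (basisVertices b) (b j) (b i) = -edgeFlux A u (basisVertices b) (b i) (b j) := by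
  rw [edgeFlux_eq A h, edgeFlux_eq A h, ← intervalIntegral.integral_neg, edgeNormal_swap,
    midpoint_comm]
  simp

theorem intervalIntegrable_edge {A : Plane → Matrix (Fin 2) (Fin 2) ℝ}
    {b : AffineBasis (Fin 3) ℝ Plane}
    (hA : ContinuousOn A (convexHull ℝ (basisVertices b : Set Plane))) (i j : Fin 3)
    (v w : Fin 2 → ℝ) :
    IntervalIntegrable (fun t : ℝ =>
      (A (AffineMap.lineMap (midpoint ℝ (b i) (b j)) (barycenter (basisVertices b)) t) *ᵥ v) ⬝ᵥ w)
      MeasureTheory.volume 0 1 := by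
  refine ContinuousOn.intervalIntegrable ?_
  rw [Set.uIcc_of_le zero_le_one]
  have h1 : ContinuousOn (fun t : ℝ =>
      A (AffineMap.lineMap (midpoint ℝ (b i) (b j)) (barycenter (basisVertices b)) t))
      (Set.Icc 0 1) :=
    hA.comp AffineMap.lineMap_continuous.continuousOn fun t ht => lineMap_mem_convexHull b i j ht
  have h2 : ∀ k l, ContinuousOn (fun t : ℝ =>
      A (AffineMap.lineMap (midpoint ℝ (b i) (b j)) (barycenter (basisVertices b)) t) k l)
      (Set.Icc 0 1) := fun k l => by
    have := continuousOn_pi.mp (continuousOn_pi.mp h1 k) l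
    exact this
  simp only [mulVec_dotProduct_eq]
  exact ((((h2 0 0).mul_const _).add ((h2 0 1).mul_const _)).mul_const _).add
    ((((h2 1 0).mul_const _).add ((h2 1 1).mul_const _)).mul_const _)

theorem abs_ofLp_le (v : Plane) (i : Fin 2) : |v.ofLp i| ≤ ‖v‖ := by
  simpa using PiLp.norm_apply_le v i

/-- The factor 4 counts the matrix entries. -/
theorem abs_mulVec_dotProduct_sub_le {M N : Matrix (Fin 2) (Fin 2) ℝ} {ε : ℝ}
    (h : ∀ i j, |M i j - N i j| ≤ ε) (v w : Plane) :
    |(M *ᵥ v.ofLp) ⬝ᵥ w.ofLp - (N *ᵥ v.ofLp) ⬝ᵥ w.ofLp| ≤ 4 * ε * (‖v‖ * ‖w‖) := by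
  have hε : 0 ≤ ε := (abs_nonneg _).trans (h 0 0)
  have key : ∀ i j, |(M i j - N i j) * (v.ofLp j * w.ofLp i)| ≤ ε * (‖v‖ * ‖w‖) := by
    intro i j
    rw [abs_mul, abs_mul]
    exact mul_le_mul (h i j) (mul_le_mul (abs_ofLp_le v j) (abs_ofLp_le w i) (abs_nonneg _)
      (norm_nonneg _)) (by positivity) hε
  have h00 := abs_le.mp (key 0 0)
  have h01 := abs_le.mp (key 0 1)
  have h10 := abs_le.mp (key 1 0)
  have h11 := abs_le.mp (key 1 1)
  rw [mulVec_dotProduct_eq, mulVec_dotProduct_eq, abs_le]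
  constructor <;> linarith

theorem abs_edgeFlux_sub_le {A : Plane → Matrix (Fin 2) (Fin 2) ℝ} {u : Plane → ℝ}
    {b : AffineBasis (Fin 3) ℝ Plane} {g : Plane →ᵃ[ℝ] ℝ}
    (h : Set.EqOn u g (convexHull ℝ (basisVertices b : Set Plane)))
    (hA : ContinuousOn A (convexHull ℝ (basisVertices b : Set Plane)))
    {M : Matrix (Fin 2) (Fin 2) ℝ} {ε : ℝ}
    (hM : ∀ x ∈ convexHull ℝ (basisVertices b : Set Plane), ∀ k l, |A x k l - M k l| ≤ ε)
    (i j : Fin 3) :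
    |edgeFlux A u (basisVertices b) (b i) (b j) -
      (M *ᵥ (gradVec g).ofLp) ⬝ᵥ (edgeNormal (basisVertices b) (b i) (b j)).ofLp| ≤
      4 * ε * (‖gradVec g‖ * ‖edgeNormal (basisVertices b) (b i) (b j)‖) := by
  rw [edgeFlux_eq A h]
  set G := gradVec g
  set n := edgeNormal (basisVertices b) (b i) (b j)
  have hc : (M *ᵥ G.ofLp) ⬝ᵥ n.ofLp = ∫ _ in (0 : ℝ)..1, (M *ᵥ G.ofLp) ⬝ᵥ n.ofLp := by simp
  rw [hc, ← intervalIntegral.integral_sub (intervalIntegrable_edge hA i j _ _)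
    intervalIntegrable_const]
  have key := intervalIntegral.norm_integral_le_of_norm_le_const (a := 0) (b := 1)
    (f := fun t : ℝ =>
      (A (AffineMap.lineMap (midpoint ℝ (b i) (b j)) (barycenter (basisVertices b)) t) *ᵥ
        G.ofLp) ⬝ᵥ n.ofLp - (M *ᵥ G.ofLp) ⬝ᵥ n.ofLp) (C := 4 * ε * (‖G‖ * ‖n‖)) fun t ht => by
    rw [Set.uIoc_of_le zero_le_one] at ht
    exact abs_mulVec_dotProduct_sub_le
      (hM _ (lineMap_mem_convexHull b i j ⟨ht.1.le, ht.2⟩)) _ _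
  rwa [sub_zero, abs_one, mul_one] at key

/-! ### Ellipticity of the diffusion form on one triangle -/

/-- The cross product of two vectors of the plane. -/
def cross (u v : Plane) : ℝ := u 0 * v 1 - u 1 * v 0

theorem inner_plane (v w : Plane) : ⟪v, w⟫ = v 0 * w 0 + v 1 * w 1 := by
  simp [PiLp.inner_apply, Fin.sum_univ_two]; ring

theorem barycenter_apply (b : AffineBasis (Fin 3) ℝ Plane) (k : Fin 2) :
    (barycenter (basisVertices b)).ofLp k = (b 0 k + b 1 k + b 2 k) / 3 := by
  rw [barycenter_basisVertices]
  simp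
  ring

theorem midpoint_apply (v w : Plane) (k : Fin 2) : (midpoint ℝ v w).ofLp k = (v k + w k) / 2 := by
  rw [midpoint_eq_smul_add, invOf_eq_inv]
  simp
  ring

theorem rot_apply_zero (v : Plane) : (rot v).ofLp 0 = v 1 := rfl

theorem rot_apply_one (v : Plane) : (rot v).ofLp 1 = -v 0 := rfl

/-- The common value shows that, with the edges taken in cyclic order, the sign in each of the three
normals is the orientation of the triangle. -/
theorem inner_rot_edge (b : AffineBasis (Fin 3) ℝ Plane) :
    ⟪rot (barycenter (basisVertices b) - midpoint ℝ (b 0) (b 1)), b 1 - b 0⟫ =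
        cross (b 1 - b 0) (b 2 - b 0) / 3 ∧
    ⟪rot (barycenter (basisVertices b) - midpoint ℝ (b 1) (b 2)), b 2 - b 1⟫ =
        cross (b 1 - b 0) (b 2 - b 0) / 3 ∧
    ⟪rot (barycenter (basisVertices b) - midpoint ℝ (b 2) (b 0)), b 0 - b 2⟫ =
        cross (b 1 - b 0) (b 2 - b 0) / 3 := by
  refine ⟨?_, ?_, ?_⟩ <;>
  · rw [inner_plane]
    simp only [rot_apply_zero, rot_apply_one, cross, PiLp.sub_apply, barycenter_apply,
      midpoint_apply]
    ring

theorem sign_mul_self_eq_abs (r : ℝ) : Real.sign r * r = |r| := by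
  rcases lt_trichotomy r 0 with h | h | h
  · rw [Real.sign_of_neg h, abs_of_neg h]; ring
  · simp [h]
  · rw [Real.sign_of_pos h, abs_of_pos h]; ring

theorem sign_div_three (r : ℝ) : Real.sign (r / 3) = Real.sign r := by
  rcases lt_trichotomy r 0 with h | h | h
  · rw [Real.sign_of_neg h, Real.sign_of_neg (by linarith)]
  · simp [h]
  · rw [Real.sign_of_pos h, Real.sign_of_pos (by linarith)]

/-- On a triangle, the finite volume form of a constant coefficient coincides with the finite
element form. -/
theorem sum_edgeNormal (b : AffineBasis (Fin 3) ℝ Plane) (G : Plane) (H : Fin 2 → ℝ) :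
    ⟪G, b 1 - b 0⟫ * (H ⬝ᵥ (edgeNormal (basisVertices b) (b 0) (b 1)).ofLp) +
      ⟪G, b 2 - b 1⟫ * (H ⬝ᵥ (edgeNormal (basisVertices b) (b 1) (b 2)).ofLp) +
      ⟪G, b 0 - b 2⟫ * (H ⬝ᵥ (edgeNormal (basisVertices b) (b 2) (b 0)).ofLp) =
    |cross (b 1 - b 0) (b 2 - b 0)| / 2 * (G.ofLp ⬝ᵥ H) := by
  obtain ⟨h0, h1, h2⟩ := inner_rot_edge b
  -- Once $|\mathrm{cross}|$ is written as sign times cross, both sides carry the same sign as a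
  -- factor, and a polynomial identity in the coordinates remains.
  rw [edgeNormal, edgeNormal, edgeNormal, h0, h1, h2, sign_div_three, ← sign_mul_self_eq_abs]
  simp only [WithLp.ofLp_smul, dotProduct_smul, smul_eq_mul]
  generalize Real.sign _ = s
  simp only [inner_plane, dotProduct, Fin.sum_univ_two, rot_apply_zero, rot_apply_one, cross,
    PiLp.sub_apply, barycenter_apply, midpoint_apply]
  ring

theorem sum_erase_basisVertices [DecidableEq Plane] (b : AffineBasis (Fin 3) ℝ Plane) (i : Fin 3)
    (f : Plane → ℝ) :
    ∑ z ∈ (basisVertices b).erase (b i), f z = f (b 0) + f (b 1) + f (b 2) - f (b i) := by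
  rw [Finset.sum_erase_eq_sub (mem_basisVertices.mpr ⟨i, rfl⟩), sum_basisVertices]

/-- Summation by parts: each dual segment borders two control volumes with opposite normals, so its
two contributions combine into the difference of `u` along the edge. -/
theorem neg_sum_edgeFlux [DecidableEq Plane] (A : Plane → Matrix (Fin 2) (Fin 2) ℝ)
    {u : Plane → ℝ} {b : AffineBasis (Fin 3) ℝ Plane} {g : Plane →ᵃ[ℝ] ℝ}
    (h : Set.EqOn u g (convexHull ℝ (basisVertices b : Set Plane))) :
    -∑ z ∈ basisVertices b, ∑ z' ∈ (basisVertices b).erase z,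
        u z * edgeFlux A u (basisVertices b) z z' =
      ⟪gradVec g, b 1 - b 0⟫ * edgeFlux A u (basisVertices b) (b 0) (b 1) +
      ⟪gradVec g, b 2 - b 1⟫ * edgeFlux A u (basisVertices b) (b 1) (b 2) +
      ⟪gradVec g, b 0 - b 2⟫ * edgeFlux A u (basisVertices b) (b 2) (b 0) := by
  simp only [sum_basisVertices, sum_erase_basisVertices, ← affineMap_sub,
    h (basis_mem_convexHull b _)]
  rw [edgeFlux_swap A h 0 1, edgeFlux_swap A h 1 2, edgeFlux_swap A h 2 0]
  ring

theorem inner_self_plane (G : Plane) : G.ofLp ⬝ᵥ G.ofLp = ‖G‖ ^ 2 := by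
  rw [← real_inner_self_eq_norm_sq, inner_plane]
  simp [dotProduct, Fin.sum_univ_two]

/-- Replacing `A` by the constant `M` gives the finite element form, which is elliptic; the rest is
the error of this replacement, summed over three edges. -/
theorem neg_sum_edgeFlux_ge [DecidableEq Plane] {A : Plane → Matrix (Fin 2) (Fin 2) ℝ}
    {u : Plane → ℝ} {b : AffineBasis (Fin 3) ℝ Plane} {g : Plane →ᵃ[ℝ] ℝ}
    (h : Set.EqOn u g (convexHull ℝ (basisVertices b : Set Plane)))
    (hA : ContinuousOn A (convexHull ℝ (basisVertices b : Set Plane)))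
    {M : Matrix (Fin 2) (Fin 2) ℝ} {ε : ℝ}
    (hM : ∀ x ∈ convexHull ℝ (basisVertices b : Set Plane), ∀ k l, |A x k l - M k l| ≤ ε)
    {β : ℝ} (hβ : ∀ ξ : Fin 2 → ℝ, β * (ξ ⬝ᵥ ξ) ≤ ξ ⬝ᵥ (M *ᵥ ξ)) {d : ℝ}
    (hd : ∀ x ∈ convexHull ℝ (basisVertices b : Set Plane),
      ∀ y ∈ convexHull ℝ (basisVertices b : Set Plane), dist x y ≤ d) :
    ‖gradVec g‖ ^ 2 * (β * (|cross (b 1 - b 0) (b 2 - b 0)| / 2) - 12 * ε * d ^ 2) ≤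
      -∑ z ∈ basisVertices b, ∑ z' ∈ (basisVertices b).erase z,
        u z * edgeFlux A u (basisVertices b) z z' := by
  rw [neg_sum_edgeFlux A h]
  set G := gradVec g
  have hd0 : 0 ≤ d := dist_nonneg.trans
    (hd _ (basis_mem_convexHull b 0) _ (basis_mem_convexHull b 0))
  have hε : 0 ≤ ε := (abs_nonneg _).trans (hM _ (basis_mem_convexHull b 0) 0 0)
  -- Per edge: the nodal difference is at most $|G|d$, the scaled normal at most $d$, and the
  -- coefficient error contributes $4\varepsilon|G|$.
  have term : ∀ i j : Fin 3,
      ⟪G, b j - b i⟫ * ((M *ᵥ G.ofLp) ⬝ᵥ (edgeNormal (basisVertices b) (b i) (b j)).ofLp) -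
        4 * ε * d ^ 2 * ‖G‖ ^ 2 ≤ ⟪G, b j - b i⟫ * edgeFlux A u (basisVertices b) (b i) (b j) := by
    intro i j
    have h1 := abs_edgeFlux_sub_le h hA hM i j
    have h2 : |⟪G, b j - b i⟫| ≤ ‖G‖ * d := (abs_real_inner_le_norm _ _).trans
      (mul_le_mul_of_nonneg_left (by
        rw [← dist_eq_norm]
        exact hd _ (basis_mem_convexHull b j) _ (basis_mem_convexHull b i)) (norm_nonneg _))
    have h3 : ‖edgeNormal (basisVertices b) (b i) (b j)‖ ≤ d :=
      (norm_edgeNormal_le _ _ _).trans (by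
        rw [← dist_eq_norm]
        exact hd _ (barycenter_mem_convexHull b) _ (midpoint_mem_convexHull b i j))
    have h4 := h1.trans (mul_le_mul_of_nonneg_left
      (mul_le_mul_of_nonneg_left h3 (norm_nonneg G)) (by positivity : 0 ≤ 4 * ε))
    have h5 := mul_le_mul h2 h4 (abs_nonneg _) (by positivity)
    rw [← abs_mul, abs_le] at h5
    linarith [h5.1]
  have key := sum_edgeNormal b G (M *ᵥ G.ofLp)
  have hp := mul_le_mul_of_nonneg_left (hβ G.ofLp)
    (by positivity : 0 ≤ |cross (b 1 - b 0) (b 2 - b 0)| / 2)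
  rw [inner_self_plane] at hp
  linarith [term 0 1, term 1 2, term 2 0]

/-- The center and two points of the disc in the coordinate directions span a cross product $r^2$.
In barycentric coordinates it is a $2\times2$ determinant times that of the triangle; the entries
are differences of numbers in $[0,1]$, so the determinant is at most 2. -/
theorem sq_le_of_closedBall_subset {b : AffineBasis (Fin 3) ℝ Plane} {c : Plane} {r : ℝ}
    (hr : 0 ≤ r) (hc : Metric.closedBall c r ⊆ convexHull ℝ (basisVertices b : Set Plane)) :
    r ^ 2 ≤ 2 * |cross (b 1 - b 0) (b 2 - b 0)| := by
  have hball : ∀ k : Fin 2, c + EuclideanSpace.single k r ∈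
      convexHull ℝ (basisVertices b : Set Plane) := fun k => hc (by
    rw [mem_closedBall_iff_norm]; simp [abs_of_nonneg hr])
  have bound : ∀ x ∈ convexHull ℝ (basisVertices b : Set Plane), ∀ i,
      0 ≤ b.coord i x ∧ b.coord i x ≤ 1 := by
    intro x hx
    have h0 := mem_convexHull_basisVertices.mp hx
    have hs := sum_coord b x
    intro i
    refine ⟨h0 i, ?_⟩
    fin_cases i <;> simp <;> linarith [h0 0, h0 1, h0 2]
  have coordinates : ∀ x : Plane, ∀ k, x k = b 0 k + b.coord 1 x * (b 1 k - b 0 k) +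
      b.coord 2 x * (b 2 k - b 0 k) := by
    intro x k
    have h1 : x k = b.coord 0 x * b 0 k + b.coord 1 x * b 1 k + b.coord 2 x * b 2 k := by
      conv_lhs => rw [eq_coord_combination b x]
      simp
    linear_combination h1 + b 0 k * sum_coord b x
  set p := c + EuclideanSpace.single (0 : Fin 2) r with hp
  set s := c + EuclideanSpace.single (1 : Fin 2) r with hs
  have hcross : r ^ 2 = cross (p - c) (s - c) := by
    simp [hp, hs, cross]; ring
  have hfac : cross (p - c) (s - c) =
      ((b.coord 1 p - b.coord 1 c) * (b.coord 2 s - b.coord 2 c) -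
        (b.coord 2 p - b.coord 2 c) * (b.coord 1 s - b.coord 1 c)) *
      cross (b 1 - b 0) (b 2 - b 0) := by
    simp only [cross, PiLp.sub_apply]
    rw [coordinates p, coordinates p, coordinates s, coordinates s, coordinates c, coordinates c]
    ring
  have hcc := bound c (hc (Metric.mem_closedBall_self hr))
  have hpp := bound p (hball 0)
  have hss := bound s (hball 1)
  have hdiff : ∀ x i, (∀ i, 0 ≤ b.coord i x ∧ b.coord i x ≤ 1) →
      |b.coord i x - b.coord i c| ≤ 1 := fun x i hx => by
    rw [abs_le]; constructor <;> linarith [hx i, hcc i]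
  have hprod : ∀ i j, |(b.coord i p - b.coord i c) * (b.coord j s - b.coord j c)| ≤ 1 :=
    fun i j => by
      rw [abs_mul]
      exact mul_le_one₀ (hdiff p i hpp) (abs_nonneg _) (hdiff s j hss)
  calc r ^ 2 ≤ |cross (p - c) (s - c)| := hcross.le.trans (le_abs_self _)
    _ ≤ 2 * |cross (b 1 - b 0) (b 2 - b 0)| := by
      rw [hfac, abs_mul]
      refine mul_le_mul_of_nonneg_right ?_ (abs_nonneg _)
      refine (abs_sub _ _).trans ?_
      linarith [hprod 1 2, hprod 2 1]

/-! ### Nonnegativity of the mass term by cyclic averaging -/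

/-- The one of the three values `w₀, w₁, w₂` whose weight is strictly the largest, and zero if
there is none. -/
def dominantValue (w₀ w₁ w₂ l₀ l₁ l₂ : ℝ) : ℝ :=
  if l₁ < l₀ ∧ l₂ < l₀ then w₀ else if l₀ < l₁ ∧ l₂ < l₁ then w₁
    else if l₀ < l₂ ∧ l₁ < l₂ then w₂ else 0

/-- Along a cyclic orbit the largest weight visits each vertex once, so the sum becomes a symmetric
quadratic form in the nodal values. Ties contribute nothing. -/
theorem dominantValue_cyclic_sum_nonneg (w₀ w₁ w₂ : ℝ) {l₀ l₁ l₂ : ℝ} (h₀ : 0 ≤ l₀) (h₁ : 0 ≤ l₁)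
    (h₂ : 0 ≤ l₂) :
    0 ≤ (l₀ * w₀ + l₁ * w₁ + l₂ * w₂) * dominantValue w₀ w₁ w₂ l₀ l₁ l₂ +
      (l₂ * w₀ + l₀ * w₁ + l₁ * w₂) * dominantValue w₀ w₁ w₂ l₂ l₀ l₁ +
      (l₁ * w₀ + l₂ * w₁ + l₀ * w₂) * dominantValue w₀ w₁ w₂ l₁ l₂ l₀ := by
  have key : ∀ a b c : ℝ, 0 ≤ b → 0 ≤ c → b < a → c < a →
      0 ≤ a * (w₀ ^ 2 + w₁ ^ 2 + w₂ ^ 2) + (b + c) * (w₀ * w₁ + w₁ * w₂ + w₂ * w₀) := by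
    intro a b c hb hc hba hca
    -- The form is $(a-\frac{b+c}2)\sum w_i^2+\frac{b+c}2(\sum w_i)^2$.
    have h1 := mul_nonneg (by linarith : 0 ≤ a - (b + c) / 2)
      (by positivity : 0 ≤ w₀ ^ 2 + w₁ ^ 2 + w₂ ^ 2)
    have h2 := mul_nonneg (by linarith : 0 ≤ (b + c) / 2) (sq_nonneg (w₀ + w₁ + w₂))
    linarith
  unfold dominantValue
  by_cases c0 : l₁ < l₀ ∧ l₂ < l₀
  · have n1 : ¬ l₀ < l₁ := not_lt.mpr c0.1.le
    have n2 : ¬ l₀ < l₂ := not_lt.mpr c0.2.le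
    simp only [c0.1, c0.2, n1, n2, and_true, and_false, false_and, if_true, if_false]
    linarith [key l₀ l₁ l₂ h₁ h₂ c0.1 c0.2]
  · by_cases c1 : l₀ < l₁ ∧ l₂ < l₁
    · have n1 : ¬ l₁ < l₀ := not_lt.mpr c1.1.le
      have n2 : ¬ l₁ < l₂ := not_lt.mpr c1.2.le
      simp only [c1.1, c1.2, n1, n2, and_true, and_false, false_and, if_true, if_false]
      linarith [key l₁ l₀ l₂ h₀ h₂ c1.1 c1.2]
    · by_cases c2 : l₀ < l₂ ∧ l₁ < l₂
      · have n1 : ¬ l₂ < l₀ := not_lt.mpr c2.1.le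
        have n2 : ¬ l₂ < l₁ := not_lt.mpr c2.2.le
        simp only [c2.1, c2.2, n1, n2, and_true, and_false, false_and, if_true,
          if_false]
        linarith [key l₂ l₀ l₁ h₀ h₁ c2.1 c2.2]
      · have c0' : ¬ (l₂ < l₀ ∧ l₁ < l₀) := fun h => c0 h.symm
        have c1' : ¬ (l₂ < l₁ ∧ l₀ < l₁) := fun h => c1 h.symm
        have c2' : ¬ (l₁ < l₂ ∧ l₀ < l₂) := fun h => c2 h.symm
        simp [c0, c1, c2, c0', c1', c2']

/-- The nodal value of `w` at the vertex with strictly largest barycentric coordinate. -/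
def dualValue (b : AffineBasis (Fin 3) ℝ Plane) (w : Plane → ℝ) (x : Plane) : ℝ :=
  dominantValue (w (b 0)) (w (b 1)) (w (b 2)) (b.coord 0 x) (b.coord 1 x) (b.coord 2 x)

theorem dualValue_eq (b : AffineBasis (Fin 3) ℝ Plane) (w : Plane → ℝ) {x : Plane} {i : Fin 3}
    (h : ∀ j, j ≠ i → b.coord j x < b.coord i x) : dualValue b w x = w (b i) := by
  unfold dualValue dominantValue
  obtain rfl | rfl | rfl : i = 0 ∨ i = 1 ∨ i = 2 := by fin_cases i <;> simp
  · simp [h 1 (by decide), h 2 (by decide)]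
  · simp [h 0 (by decide), h 2 (by decide), (h 0 (by decide)).le]
  · rw [if_neg fun hh => absurd hh.2 (not_lt.mpr (h 0 (by decide)).le),
      if_neg fun hh => absurd hh.2 (not_lt.mpr (h 1 (by decide)).le),
      if_pos ⟨h 0 (by decide), h 1 (by decide)⟩]

theorem dualValue_eq_zero_or (b : AffineBasis (Fin 3) ℝ Plane) (w : Plane → ℝ) (x : Plane) :
    dualValue b w x = 0 ∨ ∃ i, dualValue b w x = w (b i) := by
  unfold dualValue dominantValue
  split_ifs
  · exact Or.inr ⟨0, rfl⟩
  · exact Or.inr ⟨1, rfl⟩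
  · exact Or.inr ⟨2, rfl⟩
  · exact Or.inl rfl

/-- The affine map of the plane that permutes the vertices of a triangle cyclically. -/
def cyclicMap (b : AffineBasis (Fin 3) ℝ Plane) (x : Plane) : Plane :=
  b.coord 2 x • b 0 + b.coord 0 x • b 1 + b.coord 1 x • b 2

theorem coord_cyclicMap (b : AffineBasis (Fin 3) ℝ Plane) (x : Plane) :
    b.coord 0 (cyclicMap b x) = b.coord 2 x ∧ b.coord 1 (cyclicMap b x) = b.coord 0 x ∧
      b.coord 2 (cyclicMap b x) = b.coord 1 x := by
  have hs := sum_coord b x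
  unfold cyclicMap
  refine ⟨?_, ?_, ?_⟩ <;>
  · rw [affineMap_smul_add _ _ _ _ (by linarith)]
    simp [b.coord_apply]

theorem cyclicMap_iterate_three (b : AffineBasis (Fin 3) ℝ Plane) (x : Plane) :
    cyclicMap b (cyclicMap b (cyclicMap b x)) = x := by
  refine b.ext_elem fun i => ?_
  have h := coord_cyclicMap b
  fin_cases i
  · exact (h _).1.trans ((h _).2.2.trans (h x).2.1)
  · exact (h _).2.1.trans ((h _).1.trans (h x).2.2)
  · exact (h _).2.2.trans ((h _).2.1.trans (h x).1)

theorem cyclicMap_injective (b : AffineBasis (Fin 3) ℝ Plane) :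
    Function.Injective (cyclicMap b) := fun x y h => by
  rw [← cyclicMap_iterate_three b x, h, cyclicMap_iterate_three]

theorem cyclicMap_mem (b : AffineBasis (Fin 3) ℝ Plane) {x : Plane}
    (hx : x ∈ convexHull ℝ (basisVertices b : Set Plane)) :
    cyclicMap b x ∈ convexHull ℝ (basisVertices b : Set Plane) := by
  rw [mem_convexHull_basisVertices] at hx ⊢
  have h := coord_cyclicMap b x
  intro i
  fin_cases i
  · exact h.1 ▸ hx 2
  · exact h.2.1 ▸ hx 0
  · exact h.2.2 ▸ hx 1

theorem cyclicMap_image (b : AffineBasis (Fin 3) ℝ Plane) :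
    cyclicMap b '' convexHull ℝ (basisVertices b : Set Plane) =
      convexHull ℝ (basisVertices b : Set Plane) := by
  refine Set.Subset.antisymm (Set.image_subset_iff.mpr fun x hx => cyclicMap_mem b hx)
    fun x hx => ⟨_, cyclicMap_mem b (cyclicMap_mem b hx), cyclicMap_iterate_three b x⟩

/-- The linear part of `cyclicMap`. -/
def cyclicLinear (b : AffineBasis (Fin 3) ℝ Plane) : Plane →L[ℝ] Plane :=
  LinearMap.toContinuousLinearMap
    ((b.coord 2).linear.smulRight (b 0) + (b.coord 0).linear.smulRight (b 1) +
      (b.coord 1).linear.smulRight (b 2))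

theorem cyclicMap_eq (b : AffineBasis (Fin 3) ℝ Plane) (x : Plane) :
    cyclicMap b x = cyclicLinear b x + cyclicMap b 0 := by
  simp only [cyclicMap, cyclicLinear, affineMap_eq_linear_add (b.coord _) x,
    LinearMap.coe_toContinuousLinearMap', LinearMap.add_apply, LinearMap.smulRight_apply]
  module

/-- The map has order three, so the cube of its determinant is 1. -/
theorem abs_det_cyclicLinear (b : AffineBasis (Fin 3) ℝ Plane) :
    |(cyclicLinear b).det| = 1 := by
  have h3 : ∀ x, cyclicLinear b (cyclicLinear b (cyclicLinear b x)) = x := by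
    intro x
    have h := cyclicMap_iterate_three b x
    -- The identity at the origin isolates the translation part, which then cancels from `h`.
    have h0 := cyclicMap_iterate_three b 0
    rw [cyclicMap_eq b (cyclicMap b (cyclicMap b _)), cyclicMap_eq b (cyclicMap b _),
      cyclicMap_eq b _] at h h0
    simp only [map_add, map_zero, zero_add] at h h0
    rw [add_assoc, add_assoc, ← add_assoc (cyclicLinear b (cyclicLinear b (cyclicMap b 0))),
      h0, add_zero] at h
    exact h
  have hd : (cyclicLinear b).det * ((cyclicLinear b).det * (cyclicLinear b).det) = 1 := by
    have hc : (cyclicLinear b : Plane →ₗ[ℝ] Plane) ∘ₗ ((cyclicLinear b : Plane →ₗ[ℝ] Plane) ∘ₗ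
        (cyclicLinear b : Plane →ₗ[ℝ] Plane)) = LinearMap.id := by
      ext1 x; exact h3 x
    have := congrArg LinearMap.det hc
    rwa [LinearMap.det_comp, LinearMap.det_comp, LinearMap.det_id] at this
  have ha := congrArg abs hd
  rw [abs_mul, abs_mul, abs_one] at ha
  have hn := abs_nonneg (cyclicLinear b).det
  generalize |(cyclicLinear b).det| = r at ha hn
  nlinarith [mul_nonneg hn hn, sq_nonneg (r + 1)]

theorem hasFDerivAt_cyclicMap (b : AffineBasis (Fin 3) ℝ Plane) (x : Plane) :
    HasFDerivAt (cyclicMap b) (cyclicLinear b) x := by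
  rw [funext (cyclicMap_eq b)]
  exact (cyclicLinear b).hasFDerivAt.add_const _

theorem setIntegral_comp_cyclicMap (b : AffineBasis (Fin 3) ℝ Plane) (f : Plane → ℝ) :
    ∫ x in convexHull ℝ (basisVertices b : Set Plane), f (cyclicMap b x) =
      ∫ x in convexHull ℝ (basisVertices b : Set Plane), f x := by
  have h := integral_image_eq_integral_abs_det_fderiv_smul volume
    (isCompact_convexHull_finset (basisVertices b)).measurableSet
    (fun x _ => (hasFDerivAt_cyclicMap b x).hasFDerivWithinAt) (cyclicMap_injective b).injOn f
  rw [cyclicMap_image] at h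
  simpa [abs_det_cyclicLinear] using h.symm

theorem integrableOn_comp_cyclicMap (b : AffineBasis (Fin 3) ℝ Plane) {f : Plane → ℝ}
    (hf : IntegrableOn f (convexHull ℝ (basisVertices b : Set Plane))) :
    IntegrableOn (fun x => f (cyclicMap b x)) (convexHull ℝ (basisVertices b : Set Plane)) := by
  have h := integrableOn_image_iff_integrableOn_abs_det_fderiv_smul volume
    (isCompact_convexHull_finset (basisVertices b)).measurableSet
    (fun x _ => (hasFDerivAt_cyclicMap b x).hasFDerivWithinAt) (cyclicMap_injective b).injOn f
  rw [cyclicMap_image] at h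
  simpa [abs_det_cyclicLinear] using h.mp hf

/-- The cyclic map preserves the triangle and its area, so three times the integral is the integral
of the orbit sum. -/
theorem setIntegral_mul_dualValue_nonneg (b : AffineBasis (Fin 3) ℝ Plane) (g : Plane →ᵃ[ℝ] ℝ)
    (hf : IntegrableOn (fun x => g x * dualValue b g x)
      (convexHull ℝ (basisVertices b : Set Plane))) :
    0 ≤ ∫ x in convexHull ℝ (basisVertices b : Set Plane), g x * dualValue b g x := by
  set K := convexHull ℝ (basisVertices b : Set Plane)
  set f : Plane → ℝ := fun x => g x * dualValue b g x with hfdef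
  have hf1 := integrableOn_comp_cyclicMap b hf
  have hf2 := integrableOn_comp_cyclicMap b hf1
  have e1 := setIntegral_comp_cyclicMap b f
  have e2 := setIntegral_comp_cyclicMap b (fun x => f (cyclicMap b x))
  have hsum : ∫ x in K, (f x + f (cyclicMap b x) + f (cyclicMap b (cyclicMap b x))) =
      3 * ∫ x in K, f x := by
    have a1 : ∫ x in K, (f x + f (cyclicMap b x)) =
      (∫ x in K, f x) + ∫ x in K, f (cyclicMap b x) := integral_add hf hf1
    have a2 : ∫ x in K, (f x + f (cyclicMap b x) + f (cyclicMap b (cyclicMap b x))) =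
      (∫ x in K, (f x + f (cyclicMap b x))) + ∫ x in K, f (cyclicMap b (cyclicMap b x)) :=
      integral_add (hf.add hf1) hf2
    rw [a2, a1, e2, e1]
    ring
  have hnn : 0 ≤ ∫ x in K, (f x + f (cyclicMap b x) + f (cyclicMap b (cyclicMap b x))) := by
    refine setIntegral_nonneg (isCompact_convexHull_finset _).measurableSet fun x hx => ?_
    have hx' := mem_convexHull_basisVertices.mp hx
    obtain ⟨a0, a1, a2⟩ := coord_cyclicMap b x
    obtain ⟨c0, c1, c2⟩ := coord_cyclicMap b (cyclicMap b x)
    simp only [hfdef, dualValue, affineMap_eq_coord b g x, affineMap_eq_coord b g (cyclicMap b _),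
      c0, c1, c2, a0, a1, a2]
    exact dominantValue_cyclic_sum_nonneg _ _ _ (hx' 0) (hx' 1) (hx' 2)
  linarith

/-! ### Lower bound for the reaction term on one triangle -/

theorem mul_dualValue_ge (b : AffineBasis (Fin 3) ℝ Plane) (g : Plane →ᵃ[ℝ] ℝ) {d : ℝ}
    (hd : ∀ x ∈ convexHull ℝ (basisVertices b : Set Plane),
      ∀ y ∈ convexHull ℝ (basisVertices b : Set Plane), dist x y ≤ d) {x : Plane}
    (hx : x ∈ convexHull ℝ (basisVertices b : Set Plane)) :
    -(‖gradVec g‖ ^ 2 * d ^ 2 / 4) ≤ g x * dualValue b g x := by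
  rcases dualValue_eq_zero_or b g x with h | ⟨i, h⟩
  · rw [h, mul_zero]
    have : 0 ≤ ‖gradVec g‖ ^ 2 * d ^ 2 / 4 := by positivity
    linarith
  · rw [h]
    have h1 : |g (b i) - g x| ≤ ‖gradVec g‖ * d := by
      rw [affineMap_sub]
      refine (abs_real_inner_le_norm _ _).trans (mul_le_mul_of_nonneg_left ?_ (norm_nonneg _))
      rw [← dist_eq_norm]
      exact hd _ (basis_mem_convexHull b i) _ hx
    have h2 := mul_self_le_mul_self (abs_nonneg _) h1
    rw [abs_mul_abs_self] at h2
    -- Uses $4xy=(x+y)^2-(x-y)^2$.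
    linarith [sq_nonneg (g (b i) + g x)]

theorem volume_real_le_of_dist_le {s : Set Plane} {d : ℝ} (hd : 0 ≤ d)
    (h : ∀ x ∈ s, ∀ y ∈ s, dist x y ≤ d) : volume.real s ≤ Real.pi * d ^ 2 := by
  rcases s.eq_empty_or_nonempty with rfl | ⟨x, hx⟩
  · simp only [measureReal_empty]; positivity
  · have hsub : s ⊆ Metric.closedBall x d := fun y hy => h y hy x hx
    refine (measureReal_mono hsub (by
      rw [EuclideanSpace.volume_closedBall_fin_two]; finiteness)).trans ?_
    rw [measureReal_def, EuclideanSpace.volume_closedBall_fin_two]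
    simp [ENNReal.toReal_ofReal hd, ENNReal.toReal_ofReal Real.pi_pos.le, mul_comm]

/-- A variable weight `q` rules out cyclic averaging. The pointwise bound suffices, since $d^4$ is
of higher order than the $d^2$ gained from diffusion. -/
theorem setIntegral_mul_mul_dualValue_ge (b : AffineBasis (Fin 3) ℝ Plane) (g : Plane →ᵃ[ℝ] ℝ)
    {d : ℝ} (hd : ∀ x ∈ convexHull ℝ (basisVertices b : Set Plane),
      ∀ y ∈ convexHull ℝ (basisVertices b : Set Plane), dist x y ≤ d) {q : Plane → ℝ} {Q : ℝ}
    (hq : ∀ x ∈ convexHull ℝ (basisVertices b : Set Plane), 0 ≤ q x ∧ q x ≤ Q)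
    (hf : IntegrableOn (fun x => q x * g x * dualValue b g x)
      (convexHull ℝ (basisVertices b : Set Plane))) :
    -(Q * (‖gradVec g‖ ^ 2 * d ^ 2 / 4) * (Real.pi * d ^ 2)) ≤
      ∫ x in convexHull ℝ (basisVertices b : Set Plane), q x * g x * dualValue b g x := by
  have hK := isCompact_convexHull_finset (basisVertices b)
  have hQ := hq _ (basis_mem_convexHull b 0)
  have hQ0 : 0 ≤ Q := hQ.1.trans hQ.2
  have hd0 : 0 ≤ d := dist_nonneg.trans
    (hd _ (basis_mem_convexHull b 0) _ (basis_mem_convexHull b 0))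
  have h1 := setIntegral_ge_of_const_le (c := -(Q * (‖gradVec g‖ ^ 2 * d ^ 2 / 4)))
    hK.measurableSet hK.measure_lt_top.ne (fun x hx => by
      have h2 := mul_dualValue_ge b g hd hx
      have h3 : 0 ≤ ‖gradVec g‖ ^ 2 * d ^ 2 / 4 := by positivity
      obtain ⟨h4, h5⟩ := hq x hx
      rw [mul_assoc]
      nlinarith [mul_le_mul_of_nonneg_left h2 h4, mul_le_mul_of_nonneg_right h5 h3]) hf
  rw [smul_eq_mul] at h1
  refine le_trans ?_ h1
  have h6 := mul_le_mul_of_nonneg_left (volume_real_le_of_dist_le hd0 hd)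
    (by positivity : 0 ≤ Q * (‖gradVec g‖ ^ 2 * d ^ 2 / 4))
  linarith

/-! ### Null sets and the polygonal domain -/

theorem volume_affineMap_eq_zero {g : Plane →ᵃ[ℝ] ℝ} {y : Plane} (hy : g y ≠ 0) :
    volume {x : Plane | g x = 0} = 0 := by
  set s : AffineSubspace ℝ Plane := AffineSubspace.comap g (AffineSubspace.mk' (0 : ℝ) ⊥) with hs
  have hmem : ∀ x, x ∈ s ↔ g x = 0 := fun x => by
    rw [hs, AffineSubspace.mem_comap, AffineSubspace.mem_mk']; simp
  have hset : {x : Plane | g x = 0} = s := by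
    ext x; exact (hmem x).symm
  rw [hset]
  refine Measure.addHaar_affineSubspace _ _ fun h => hy ?_
  rw [← hmem, h]
  trivial

theorem coord_eq_zero_of_mem_convexHull {b : AffineBasis (Fin 3) ℝ Plane} {S : Set Plane}
    (hS : S ⊆ basisVertices b) {i : Fin 3} (hi : b i ∉ S) {x : Plane} (hx : x ∈ convexHull ℝ S) :
    b.coord i x = 0 := by
  have hc : Convex ℝ (b.coord i ⁻¹' {0}) := (convex_singleton (0 : ℝ)).affine_preimage _
  refine convexHull_min (fun z hz => ?_) hc hx
  obtain ⟨j, rfl⟩ := mem_basisVertices.mp (Finset.mem_coe.mp (hS hz))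
  exact b.coord_apply_ne fun h => hi (h ▸ hz)

namespace IsConvexPolygonalDomain

variable {Ω : Set Plane}

theorem isOpen (hΩ : IsConvexPolygonalDomain Ω) : IsOpen Ω := by
  obtain ⟨-, P, rfl⟩ := hΩ
  exact isOpen_interior

theorem isCompact_closure (hΩ : IsConvexPolygonalDomain Ω) : IsCompact (closure Ω) := by
  obtain ⟨-, P, rfl⟩ := hΩ
  exact (isCompact_convexHull_finset P).closure_of_subset interior_subset

theorem ae_eq_closure (hΩ : IsConvexPolygonalDomain Ω) :
    (Ω : Set Plane) =ᵐ[volume] closure Ω := by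
  have hconv : Convex ℝ Ω := by
    obtain ⟨-, P, rfl⟩ := hΩ
    exact (convex_convexHull ℝ _).interior
  refine Filter.EventuallyLE.antisymm (LE.le.eventuallyLE subset_closure) ?_
  rw [ae_le_set, ← hΩ.isOpen.frontier_eq]
  exact hconv.addHaar_frontier volume

end IsConvexPolygonalDomain

/-! ### Assembling the triangles of a mesh -/

namespace Triangulation

variable {Ω : Set Plane} (𝒯 : Triangulation Ω)

theorem exists_basis {K : Finset Plane} (hK : K ∈ 𝒯.triangles) :
    ∃ b : AffineBasis (Fin 3) ℝ Plane, K = basisVertices b :=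
  exists_basisVertices_eq (𝒯.card_eq K hK) (𝒯.indep K hK)

theorem convexHull_subset_closure {K : Finset Plane} (hK : K ∈ 𝒯.triangles) :
    convexHull ℝ (K : Set Plane) ⊆ closure Ω := by
  rw [← 𝒯.cover]
  exact Set.subset_biUnion_of_mem (u := fun K : Finset Plane => convexHull ℝ (K : Set Plane)) hK

theorem dist_le_meshSize {K : Finset Plane} (hK : K ∈ 𝒯.triangles) {x y : Plane}
    (hx : x ∈ convexHull ℝ (K : Set Plane)) (hy : y ∈ convexHull ℝ (K : Set Plane)) :
    dist x y ≤ 𝒯.meshSize :=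
  (Metric.dist_le_diam_of_mem (isCompact_convexHull_finset K).isBounded hx hy).trans
    (le_ciSup (f := fun K : 𝒯.triangles =>
      Metric.diam (convexHull ℝ ((K : Finset Plane) : Set Plane)))
      (Set.finite_range _).bddAbove ⟨K, hK⟩)

theorem meshSize_pos_of_mem {K : Finset Plane} (hK : K ∈ 𝒯.triangles) : 0 < 𝒯.meshSize := by
  obtain ⟨b, rfl⟩ := 𝒯.exists_basis hK
  exact (dist_pos.mpr (b.ind.injective.ne (by decide : (0 : Fin 3) ≠ 1))).trans_le
    (𝒯.dist_le_meshSize hK (basis_mem_convexHull b 0) (basis_mem_convexHull b 1))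

theorem mem_vertices {z : Plane} : z ∈ 𝒯.vertices ↔ ∃ K ∈ 𝒯.triangles, z ∈ K := by
  simp [vertices]

theorem mem_interiorVertices {z : Plane} : z ∈ 𝒯.interiorVertices ↔ z ∈ 𝒯.vertices ∧ z ∈ Ω := by
  simp [interiorVertices]

theorem mem_trianglesAt {z : Plane} {K : Finset Plane} :
    K ∈ 𝒯.trianglesAt z ↔ K ∈ 𝒯.triangles ∧ z ∈ K := by
  simp [trianglesAt]

theorem mem_controlVolume {z x : Plane} : x ∈ 𝒯.controlVolume z ↔ ∃ K ∈ 𝒯.triangles, z ∈ K ∧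
    x ∈ convexHull ℝ (insert (barycenter K) (midpoint ℝ z '' (K : Set Plane))) := by
  simp only [controlVolume, Set.mem_iUnion, exists_prop, mem_trianglesAt, and_assoc]

theorem isClosed_controlVolume (z : Plane) : IsClosed (𝒯.controlVolume z) :=
  (𝒯.trianglesAt z).finite_toSet.isClosed_biUnion fun K _ =>
    (((K.finite_toSet.image _).insert _).isCompact_convexHull (𝕜 := ℝ)).isClosed

theorem volume_inter_eq_zero {K L : Finset Plane} (hK : K ∈ 𝒯.triangles) (hL : L ∈ 𝒯.triangles)
    (hKL : K ≠ L) :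
    volume (convexHull ℝ (K : Set Plane) ∩ convexHull ℝ (L : Set Plane)) = 0 := by
  obtain ⟨b, rfl⟩ := 𝒯.exists_basis hK
  have hn : ¬ basisVertices b ⊆ L := fun h => hKL
    (Finset.eq_of_subset_of_card_le h (by rw [𝒯.card_eq _ hK, 𝒯.card_eq _ hL]))
  obtain ⟨z, hz, hzL⟩ := Finset.not_subset.mp hn
  obtain ⟨i, rfl⟩ := mem_basisVertices.mp hz
  rw [𝒯.inter_eq _ hK _ hL]
  refine measure_mono_null (fun x hx => ?_)
    (volume_affineMap_eq_zero (g := b.coord i) (y := b i) (by simp))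
  exact coord_eq_zero_of_mem_convexHull Set.inter_subset_left (fun h => hzL h.2) hx

/-- Conformity excludes hanging nodes: the intersection of two triangles is spanned by common
vertices, and a vertex is not in the hull of the others. -/
theorem mem_of_vertex_mem_convexHull {z : Plane} (hz : z ∈ 𝒯.vertices) {L : Finset Plane}
    (hL : L ∈ 𝒯.triangles) (h : z ∈ convexHull ℝ (L : Set Plane)) : z ∈ L := by
  obtain ⟨K, hK, hzK⟩ := 𝒯.mem_vertices.mp hz
  obtain ⟨b, rfl⟩ := 𝒯.exists_basis hK
  obtain ⟨i, rfl⟩ := mem_basisVertices.mp hzK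
  by_contra hn
  have hmem : b i ∈ convexHull ℝ ((basisVertices b : Set Plane) ∩ L) := by
    rw [← 𝒯.inter_eq _ hK _ hL]
    exact ⟨basis_mem_convexHull b i, h⟩
  have := coord_eq_zero_of_mem_convexHull Set.inter_subset_left (fun h => hn h.2) hmem
  simp at this

/-- The sum in `dualInterp` omits boundary vertices, which is harmless because `v` vanishes there.
-/
theorem dualInterp_eq_of_unique {v : Plane → ℝ} (hv : ∀ x ∉ Ω, v x = 0) {x z₀ : Plane}
    (hz₀ : z₀ ∈ 𝒯.vertices) (h : ∀ z ∈ 𝒯.vertices, x ∈ 𝒯.controlVolume z ↔ z = z₀) :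
    𝒯.dualInterp v x = v z₀ := by
  unfold dualInterp
  rw [Finset.sum_eq_single z₀]
  · rw [Set.indicator_of_mem ((h z₀ hz₀).mpr rfl), mul_one]
  · intro z hz hne
    rw [Set.indicator_of_notMem, mul_zero]
    exact fun hx => hne ((h z (𝒯.mem_interiorVertices.mp hz).1).mp hx)
  · intro hz
    rw [hv z₀ fun hΩ => hz (𝒯.mem_interiorVertices.mpr ⟨hz₀, hΩ⟩), zero_mul]

theorem dualInterp_vertex {v : Plane → ℝ} (hv : ∀ x ∉ Ω, v x = 0) {z₀ : Plane}
    (hz₀ : z₀ ∈ 𝒯.vertices) : 𝒯.dualInterp v z₀ = v z₀ := by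
  refine 𝒯.dualInterp_eq_of_unique hv hz₀ fun z hz => ?_
  rw [mem_controlVolume]
  constructor
  · rintro ⟨K, hK, hzK, hmem⟩
    obtain ⟨b, rfl⟩ := 𝒯.exists_basis hK
    obtain ⟨i, rfl⟩ := mem_basisVertices.mp hzK
    rw [mem_dualQuad_iff] at hmem
    have hz₀K := 𝒯.mem_of_vertex_mem_convexHull hz₀ hK (mem_convexHull_basisVertices.mpr hmem.1)
    obtain ⟨j, rfl⟩ := mem_basisVertices.mp hz₀K
    by_contra hne
    have h1 := hmem.2 j
    rw [b.coord_apply_eq, b.coord_apply_ne fun h => hne (congrArg b h)] at h1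
    linarith
  · rintro rfl
    obtain ⟨K, hK, hzK⟩ := 𝒯.mem_vertices.mp hz
    refine ⟨K, hK, hzK, subset_convexHull _ _ (Set.mem_insert_of_mem _ ⟨z, hzK, ?_⟩)⟩
    simp

/-- Off the overlaps with other triangles and the lines where two barycentric coordinates agree,
both null sets, a point of the triangle lies in exactly one control volume. -/
theorem ae_dualInterp_eq_dualValue {v : Plane → ℝ} (hv : ∀ x ∉ Ω, v x = 0)
    {b : AffineBasis (Fin 3) ℝ Plane} (hb : basisVertices b ∈ 𝒯.triangles) :
    ∀ᵐ x : Plane, x ∈ convexHull ℝ (basisVertices b : Set Plane) →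
      𝒯.dualInterp v x = dualValue b v x := by
  have h1 : ∀ᵐ x : Plane, ∀ L ∈ 𝒯.triangles, basisVertices b ≠ L →
      x ∉ convexHull ℝ (basisVertices b : Set Plane) ∩ convexHull ℝ (L : Set Plane) := by
    rw [Filter.eventually_all_finset]
    intro L hL
    by_cases hne : basisVertices b = L
    · exact Filter.Eventually.of_forall fun x h => absurd hne h
    · filter_upwards [measure_eq_zero_iff_ae_notMem.mp (𝒯.volume_inter_eq_zero hb hL hne)]
        with x hx _ using hx
  have h2 : ∀ᵐ x : Plane, ∀ i j : Fin 3, i ≠ j → b.coord i x ≠ b.coord j x := by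
    rw [ae_all_iff]; intro i
    rw [ae_all_iff]; intro j
    by_cases hij : i = j
    · exact Filter.Eventually.of_forall fun x h => absurd hij h
    · have hn : volume {x : Plane | (b.coord i - b.coord j) x = 0} = 0 :=
        volume_affineMap_eq_zero (y := b i) (by
          simp [b.coord_apply_ne (Ne.symm hij)])
      filter_upwards [measure_eq_zero_iff_ae_notMem.mp hn] with x hx _ h
      exact hx (by simp [h])
  filter_upwards [h1, h2] with x hx1 hx2 hxK
  obtain ⟨i, hi⟩ := Finite.exists_max fun i => b.coord i x
  have hlt : ∀ j, j ≠ i → b.coord j x < b.coord i x := fun j hj =>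
    lt_of_le_of_ne (hi j) (hx2 j i hj)
  rw [dualValue_eq b v hlt]
  refine 𝒯.dualInterp_eq_of_unique hv
    (𝒯.mem_vertices.mpr ⟨_, hb, mem_basisVertices.mpr ⟨i, rfl⟩⟩) fun z hz => ?_
  rw [mem_controlVolume]
  constructor
  · rintro ⟨L, hL, hzL, hmem⟩
    have hLb : basisVertices b = L := by
      by_contra hne
      obtain ⟨c, rfl⟩ := 𝒯.exists_basis hL
      obtain ⟨j, rfl⟩ := mem_basisVertices.mp hzL
      exact hx1 _ hL hne ⟨hxK, mem_convexHull_basisVertices.mpr (mem_dualQuad_iff.mp hmem).1⟩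
    subst hLb
    obtain ⟨j, rfl⟩ := mem_basisVertices.mp hzL
    by_contra hne
    have h3 := (mem_dualQuad_iff.mp hmem).2 i
    exact absurd (hlt j fun h => hne (h ▸ rfl)) (not_lt.mpr h3)
  · rintro rfl
    exact ⟨_, hb, mem_basisVertices.mpr ⟨i, rfl⟩,
      mem_dualQuad_iff.mpr ⟨mem_convexHull_basisVertices.mp hxK, hi⟩⟩

theorem integrableOn_mul_dualInterp (hΩ : IsConvexPolygonalDomain Ω) {ψ : Plane → ℝ}
    (hψ : ContinuousOn ψ (closure Ω)) (v : Plane → ℝ) :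
    IntegrableOn (fun x => ψ x * 𝒯.dualInterp v x) (closure Ω) := by
  have h : (fun x => ψ x * 𝒯.dualInterp v x) = fun x => ∑ z ∈ 𝒯.interiorVertices,
      v z * (𝒯.controlVolume z).indicator ψ x := by
    ext x
    simp only [dualInterp, Finset.mul_sum]
    refine Finset.sum_congr rfl fun z _ => ?_
    by_cases hx : x ∈ 𝒯.controlVolume z <;> simp [hx, mul_comm]
  rw [h]
  exact integrable_finsetSum _ fun z _ => ((hψ.integrableOn_compact hΩ.isCompact_closure).indicator
    (𝒯.isClosed_controlVolume z).measurableSet).const_mul _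

/-- Triangles overlap in null sets, and the boundary of a convex set is null. -/
theorem setIntegral_eq_sum (hΩ : IsConvexPolygonalDomain Ω) {f : Plane → ℝ}
    (hf : IntegrableOn f (closure Ω)) :
    ∫ x in Ω, f x = ∑ K ∈ 𝒯.triangles, ∫ x in convexHull ℝ (K : Set Plane), f x := by
  have hU : closure Ω = ⋃ K : 𝒯.triangles, convexHull ℝ ((K : Finset Plane) : Set Plane) := by
    rw [← 𝒯.cover, Set.iUnion_subtype]
  rw [setIntegral_congr_set hΩ.ae_eq_closure, hU, integral_iUnion_ae, tsum_fintype,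
    Finset.sum_coe_sort 𝒯.triangles fun K => ∫ x in convexHull ℝ (K : Set Plane), f x]
  · exact fun K => (isCompact_convexHull_finset _).measurableSet.nullMeasurableSet
  · exact fun K L hKL => 𝒯.volume_inter_eq_zero K.2 L.2 fun h => hKL (Subtype.ext h)
  · rwa [← hU]

theorem diffusionForm_dualInterp [DecidableEq Plane] (A : Plane → Matrix (Fin 2) (Fin 2) ℝ)
    (u : Plane → ℝ) {v : Plane → ℝ} (hv : ∀ x ∉ Ω, v x = 0) :
    𝒯.diffusionForm A u (𝒯.dualInterp v) =
      ∑ K ∈ 𝒯.triangles, -∑ z ∈ K, ∑ z' ∈ K.erase z, v z * edgeFlux A u K z z' := by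
  have hflux : ∀ z, 𝒯.flux A u z = ∑ K ∈ 𝒯.trianglesAt z, ∑ z' ∈ K.erase z, edgeFlux A u K z z' := by
    intro z
    unfold flux edgeFlux
    congr!
  rw [diffusionForm, Finset.sum_neg_distrib, neg_inj]
  have h1 : ∀ z ∈ 𝒯.vertices, 𝒯.dualInterp v z * 𝒯.flux A u z =
      ∑ K ∈ 𝒯.trianglesAt z, ∑ z' ∈ K.erase z, v z * edgeFlux A u K z z' := fun z hz => by
    rw [𝒯.dualInterp_vertex hv hz, hflux, Finset.mul_sum]
    exact Finset.sum_congr rfl fun K _ => Finset.mul_sum _ _ _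
  rw [Finset.sum_congr rfl h1]
  -- Exchange the sum over vertices and their triangles for one over triangles and their vertices.
  refine Finset.sum_comm' fun z K => ?_
  rw [mem_trianglesAt, mem_vertices]
  exact ⟨fun h => ⟨h.2.2, h.2.1⟩, fun h => ⟨⟨K, h.2, h.1⟩, h.2, h.1⟩⟩

end Triangulation

/-! ### Positivity of the global forms -/

theorem dualValue_congr {b : AffineBasis (Fin 3) ℝ Plane} {v w : Plane → ℝ}
    (h : Set.EqOn v w (convexHull ℝ (basisVertices b : Set Plane))) (x : Plane) :
    dualValue b v x = dualValue b w x := by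
  simp only [dualValue, h (basis_mem_convexHull b _)]

namespace Triangulation

variable {Ω : Set Plane} (𝒯 : Triangulation Ω)

theorem setIntegral_mul_dualInterp (hΩ : IsConvexPolygonalDomain Ω) {ψ φ : Plane → ℝ}
    (hψ : ContinuousOn ψ (closure Ω)) {v : Plane → ℝ} (hv : ∀ x ∉ Ω, v x = 0)
    {b : AffineBasis (Fin 3) ℝ Plane} (hb : basisVertices b ∈ 𝒯.triangles) {g : Plane → ℝ}
    (hg : Set.EqOn v g (convexHull ℝ (basisVertices b : Set Plane)))
    (hφ : Set.EqOn ψ φ (convexHull ℝ (basisVertices b : Set Plane))) :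
    IntegrableOn (fun x => φ x * dualValue b g x) (convexHull ℝ (basisVertices b : Set Plane)) ∧
    ∫ x in convexHull ℝ (basisVertices b : Set Plane), ψ x * 𝒯.dualInterp v x =
      ∫ x in convexHull ℝ (basisVertices b : Set Plane), φ x * dualValue b g x := by
  have hK := (isCompact_convexHull_finset (basisVertices b)).measurableSet
  have hae : ∀ᵐ x : Plane, x ∈ convexHull ℝ (basisVertices b : Set Plane) →
      ψ x * 𝒯.dualInterp v x = φ x * dualValue b g x := by
    filter_upwards [𝒯.ae_dualInterp_eq_dualValue hv hb] with x hx hxK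
    rw [hx hxK, hφ hxK, dualValue_congr hg]
  refine ⟨?_, setIntegral_congr_ae hK hae⟩
  exact ((𝒯.integrableOn_mul_dualInterp hΩ hψ v).mono_set
    (𝒯.convexHull_subset_closure hb)).congr ((ae_restrict_iff' hK).mpr hae)

theorem inner2_self_dualInterp_nonneg (hΩ : IsConvexPolygonalDomain Ω) {w : Plane → ℝ}
    (hw : w ∈ 𝒯.trialSpace) : 0 ≤ inner2 Ω w (𝒯.dualInterp w) := by
  obtain ⟨hc, h0, haff⟩ := hw
  rw [inner2, 𝒯.setIntegral_eq_sum hΩ (𝒯.integrableOn_mul_dualInterp hΩ hc.continuousOn w)]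
  refine Finset.sum_nonneg fun K hK => ?_
  obtain ⟨g, hg⟩ := haff K hK
  obtain ⟨b, rfl⟩ := 𝒯.exists_basis hK
  obtain ⟨hint, heq⟩ := 𝒯.setIntegral_mul_dualInterp hΩ hc.continuousOn h0 hK hg hg
  rw [heq]
  exact setIntegral_mul_dualValue_nonneg b g hint

/-- The range of `w` is finite and, by continuity on the plane, connected, hence a single value;
this is 0 because `w` vanishes outside a bounded set. -/
theorem eq_zero_of_const_on_triangles (hΩ : IsConvexPolygonalDomain Ω) {w : Plane → ℝ}
    (hw : w ∈ 𝒯.trialSpace)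
    (h : ∀ K ∈ 𝒯.triangles, ∃ c, ∀ x ∈ convexHull ℝ (K : Set Plane), w x = c) : w = 0 := by
  obtain ⟨hc, h0, -⟩ := hw
  choose! c hcK using h
  have hsub : Set.range w ⊆ insert 0 (c '' (𝒯.triangles : Set (Finset Plane))) := by
    rintro _ ⟨x, rfl⟩
    by_cases hx : x ∈ Ω
    · have hx' : x ∈ closure Ω := subset_closure hx
      rw [← 𝒯.cover] at hx'
      obtain ⟨K, hK, hxK⟩ := Set.mem_iUnion₂.mp hx'
      exact Set.mem_insert_of_mem _ ⟨K, hK, (hcK K hK x hxK).symm⟩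
    · rw [h0 x hx]; exact Set.mem_insert _ _
  have hfin : (Set.range w).Finite := ((𝒯.triangles.finite_toSet.image c).insert 0).subset hsub
  have hss : (Set.range w).Subsingleton :=
    hfin.countable.isTotallyDisconnected _ subset_rfl (isPreconnected_range hc)
  obtain ⟨y, hy⟩ : ∃ y, y ∉ closure Ω := by
    by_contra hcon
    push Not at hcon
    exact hΩ.isCompact_closure.ne_univ (Set.eq_univ_of_forall hcon)
  ext x
  exact (hss ⟨x, rfl⟩ ⟨y, rfl⟩).trans (h0 y fun hyΩ => hy (subset_closure hyΩ))

/-- Ellipticity supplies $\beta\rho^2/4$ in units of $|G|^2h^2$. The hypotheses `hε` and `hQ` let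
coefficient oscillation and reaction consume $\beta\rho^2/16$ each, which leaves $\beta\rho^2/8$. -/
theorem diffusionForm_add_inner2_pos (hΩ : IsConvexPolygonalDomain Ω)
    {A : Plane → Matrix (Fin 2) (Fin 2) ℝ} (hA : ContinuousOn A (closure Ω)) {β : ℝ} (hβ : 0 < β)
    (hA_pos : ∀ x ∈ closure Ω, ∀ ξ : Fin 2 → ℝ, β * (ξ ⬝ᵥ ξ) ≤ ξ ⬝ᵥ (A x *ᵥ ξ))
    {q : Plane → ℝ} (hq : ContinuousOn q (closure Ω)) {Q : ℝ}
    (hqQ : ∀ x ∈ closure Ω, 0 ≤ q x ∧ q x ≤ Q) {ρ : ℝ} (hρ : 0 < ρ) (h𝒯 : 𝒯.IsQuasiUniform ρ)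
    {ε : ℝ} (hε : 12 * ε ≤ β * ρ ^ 2 / 16)
    (hosc : ∀ x ∈ closure Ω, ∀ y ∈ closure Ω, dist x y ≤ 𝒯.meshSize →
      ∀ k l, |A x k l - A y k l| ≤ ε)
    (hQ : Q * (Real.pi * 𝒯.meshSize ^ 2) / 4 ≤ β * ρ ^ 2 / 16)
    {w : Plane → ℝ} (hw : w ∈ 𝒯.trialSpace) (hw0 : w ≠ 0) :
    0 < 𝒯.diffusionForm A w (𝒯.dualInterp w) +
      inner2 Ω (fun x => q x * w x) (𝒯.dualInterp w) := by
  classical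
  obtain ⟨hc, h0, haff⟩ := id hw
  have hqw : ContinuousOn (fun x => q x * w x) (closure Ω) := hq.mul hc.continuousOn
  rw [inner2, 𝒯.setIntegral_eq_sum hΩ (𝒯.integrableOn_mul_dualInterp hΩ hqw w),
    𝒯.diffusionForm_dualInterp A w h0, ← Finset.sum_add_distrib]
  choose! g hg using haff
  set d := 𝒯.meshSize with hd
  have local_bound : ∀ K ∈ 𝒯.triangles, ‖gradVec (g K)‖ ^ 2 * d ^ 2 * (β * ρ ^ 2 / 8) ≤
      (-∑ z ∈ K, ∑ z' ∈ K.erase z, w z * edgeFlux A w K z z') +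
        ∫ x in convexHull ℝ (K : Set Plane), q x * w x * 𝒯.dualInterp w x := by
    intro K hK
    have hgK := hg K hK
    have hsub := 𝒯.convexHull_subset_closure hK
    have hdist : ∀ x ∈ convexHull ℝ (K : Set Plane), ∀ y ∈ convexHull ℝ (K : Set Plane),
        dist x y ≤ d := fun x hx y hy => 𝒯.dist_le_meshSize hK hx hy
    obtain ⟨c, hcK⟩ := h𝒯 K hK
    have hd0 := 𝒯.meshSize_pos_of_mem hK
    generalize g K = g' at hgK
    obtain ⟨b, rfl⟩ := 𝒯.exists_basis hK
    have hb0 := hsub (basis_mem_convexHull b 0)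
    -- The coefficient is frozen at the vertex `b 0`.
    have h1 := neg_sum_edgeFlux_ge hgK (hA.mono hsub) (M := A (b 0)) (ε := ε)
      (fun x hx k l => hosc x (hsub hx) _ hb0 (hdist x hx _ (basis_mem_convexHull b 0)) k l)
      (hA_pos _ hb0) hdist
    have h2 := sq_le_of_closedBall_subset (mul_nonneg hρ.le hd0.le) hcK
    obtain ⟨hint, heq⟩ := 𝒯.setIntegral_mul_dualInterp hΩ hqw h0 hK hgK
      (φ := fun x => q x * g' x) (fun x hx => by simp only [hgK hx])
    have h3 := setIntegral_mul_mul_dualValue_ge b g' hdist (fun x hx => hqQ x (hsub hx)) hint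
    rw [heq]
    refine le_trans ?_ (add_le_add h1 h3)
    have hG : 0 ≤ ‖gradVec g'‖ ^ 2 := by positivity
    have h4 : β * (ρ ^ 2 * d ^ 2) / 4 ≤ β * (|cross (b 1 - b 0) (b 2 - b 0)| / 2) := by
      rw [mul_pow] at h2
      nlinarith
    have h5 := mul_le_mul_of_nonneg_right hε (sq_nonneg d)
    have h6 := mul_le_mul_of_nonneg_right hQ (sq_nonneg d)
    have h7 : d ^ 2 * (β * ρ ^ 2 / 8) ≤ β * (|cross (b 1 - b 0) (b 2 - b 0)| / 2) -
        12 * ε * d ^ 2 - Q * (Real.pi * d ^ 2) / 4 * d ^ 2 := by linarith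
    linarith [mul_le_mul_of_nonneg_left h7 hG]
  -- It remains to find one triangle with a positive contribution; if there is none, all gradients
  -- vanish.
  refine Finset.sum_pos' (fun K hK => le_trans (by positivity) (local_bound K hK)) ?_
  by_contra hcon
  push Not at hcon
  refine hw0 (𝒯.eq_zero_of_const_on_triangles hΩ hw fun K hK => ⟨g K 0, fun x hx => ?_⟩)
  have h1 := (local_bound K hK).trans (hcon K hK)
  have hd0 := 𝒯.meshSize_pos_of_mem hK
  have hG : gradVec (g K) = 0 := by
    by_contra hne
    have : 0 < ‖gradVec (g K)‖ := norm_pos_iff.mpr hne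
    have : 0 < ‖gradVec (g K)‖ ^ 2 * d ^ 2 * (β * ρ ^ 2 / 8) := by positivity
    linarith
  rw [hg K hK hx, ← sub_eq_zero, affineMap_sub, hG, inner_zero_left]

theorem systemForm_pos (hΩ : IsConvexPolygonalDomain Ω) {A : Plane → Matrix (Fin 2) (Fin 2) ℝ}
    {q : Plane → ℝ} {α τ : ℝ} (hα : α < 1) (hτ : 0 < τ) {w : Plane → ℝ} (hw : w ∈ 𝒯.trialSpace)
    (h : 0 < 𝒯.diffusionForm A w (𝒯.dualInterp w) +
      inner2 Ω (fun x => q x * w x) (𝒯.dualInterp w)) :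
    0 < 𝒯.systemForm A q α τ w w := by
  have h1 := mul_nonneg (inv_pos.mpr (Real.Gamma_pos_of_pos (by linarith : 0 < 2 - α))).le
    (𝒯.inner2_self_dualInterp_nonneg hΩ hw)
  have h2 := mul_pos (Real.rpow_pos_of_pos hτ α) h
  rw [systemForm]
  linarith

end Triangulation

/-! ### Choice of the mesh size threshold -/

theorem exists_meshSize_bound {S : Set Plane} (hS : IsCompact S)
    {A : Plane → Matrix (Fin 2) (Fin 2) ℝ} (hA : ContinuousOn A S) {ε : ℝ} (hε : 0 < ε) :
    ∃ δ > 0, ∀ x ∈ S, ∀ y ∈ S, dist x y ≤ δ → ∀ k l, |A x k l - A y k l| ≤ ε := by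
  have h : ∀ k l, ∃ δ > 0, ∀ x ∈ S, ∀ y ∈ S, dist x y < δ → dist (A x k l) (A y k l) < ε := by
    intro k l
    have hc : ContinuousOn (fun x => A x k l) S :=
      continuousOn_pi.mp (continuousOn_pi.mp hA k) l
    exact Metric.uniformContinuousOn_iff.mp (hS.uniformContinuousOn_of_continuous hc) ε hε
  choose δ hδ hδε using h
  -- Halving turns the non-strict bound on the distance into the strict one of uniform continuity.
  refine ⟨min (min (δ 0 0) (δ 0 1)) (min (δ 1 0) (δ 1 1)) / 2, ?_, fun x hx y hy hxy k l => ?_⟩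
  · have := lt_min (lt_min (hδ 0 0) (hδ 0 1)) (lt_min (hδ 1 0) (hδ 1 1))
    exact half_pos this
  · have hpos := lt_min (lt_min (hδ 0 0) (hδ 0 1)) (lt_min (hδ 1 0) (hδ 1 1))
    have hlt := hxy.trans_lt (half_lt_self hpos)
    rw [lt_min_iff, lt_min_iff, lt_min_iff] at hlt
    have hkl : dist x y < δ k l := by
      fin_cases k <;> fin_cases l
      · exact hlt.1.1
      · exact hlt.1.2
      · exact hlt.2.1
      · exact hlt.2.2
    exact (hδε k l x hx y hy hkl).le

theorem exists_systemForm_pos {Ω : Set Plane} (hΩ : IsConvexPolygonalDomain Ω)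
    {A : Plane → Matrix (Fin 2) (Fin 2) ℝ} (hA : ContinuousOn A (closure Ω)) {β : ℝ} (hβ : 0 < β)
    (hA_pos : ∀ x ∈ closure Ω, ∀ ξ : Fin 2 → ℝ, β * (ξ ⬝ᵥ ξ) ≤ ξ ⬝ᵥ (A x *ᵥ ξ))
    {q : Plane → ℝ} (hq : ContinuousOn q (closure Ω)) (hq_nonneg : ∀ x ∈ closure Ω, 0 ≤ q x)
    {ρ : ℝ} (hρ : 0 < ρ) :
    ∃ h₀ : ℝ, 0 < h₀ ∧ ∀ 𝒯 : Triangulation Ω, 𝒯.IsQuasiUniform ρ → 𝒯.meshSize ≤ h₀ →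
      ∀ α : ℝ, α < 1 → ∀ τ : ℝ, 0 < τ → ∀ w ∈ 𝒯.trialSpace, w ≠ 0 →
        0 < 𝒯.systemForm A q α τ w w := by
  obtain ⟨Q, hQ⟩ := hΩ.isCompact_closure.exists_bound_of_continuousOn hq
  -- The bound `|Q| + 1` is strictly positive, so it may stand in the denominator of `r`.
  have hqQ : ∀ x ∈ closure Ω, 0 ≤ q x ∧ q x ≤ |Q| + 1 := fun x hx =>
    ⟨hq_nonneg x hx, by linarith [le_abs_self (q x), hQ x hx, le_abs_self Q, Real.norm_eq_abs (q x)]⟩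
  -- Here $192=12\cdot16$, so that $12\varepsilon=\beta\rho^2/16$; `r` below gives equality in the
  -- reaction condition.
  obtain ⟨δ, hδ, hosc⟩ := exists_meshSize_bound hΩ.isCompact_closure hA
    (by positivity : 0 < β * ρ ^ 2 / 192)
  set r := Real.sqrt (β * ρ ^ 2 / (4 * Real.pi * (|Q| + 1))) with hr
  have hpi := Real.pi_pos
  have hr0 : 0 < r := Real.sqrt_pos.mpr (by positivity)
  refine ⟨min δ r, lt_min hδ hr0, fun 𝒯 h𝒯 hmesh α hα τ hτ w hw hw0 => ?_⟩
  refine 𝒯.systemForm_pos hΩ hα hτ hw (𝒯.diffusionForm_add_inner2_pos hΩ hA hβ hA_pos hq hqQ hρ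
    h𝒯 (ε := β * ρ ^ 2 / 192) (by linarith) (fun x hx y hy hxy =>
      hosc x hx y hy (hxy.trans (hmesh.trans (min_le_left _ _)))) ?_ hw hw0)
  rcases le_or_gt 𝒯.meshSize 0 with hneg | hpos
  · have : 𝒯.meshSize = 0 := le_antisymm hneg (Real.iSup_nonneg fun _ => Metric.diam_nonneg)
    rw [this]
    have : 0 ≤ β * ρ ^ 2 / 16 := by positivity
    simpa using this
  · have h1 : 𝒯.meshSize ^ 2 ≤ r ^ 2 :=
      pow_le_pow_left₀ hpos.le (hmesh.trans (min_le_right _ _)) 2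
    rw [hr, Real.sq_sqrt (by positivity), le_div_iff₀ (by positivity)] at h1
    linarith

/-! ### Linearity and unique solvability of one time step -/

theorem gradVec_add (g g' : Plane →ᵃ[ℝ] ℝ) : gradVec (g + g') = gradVec g + gradVec g' := by
  simp [gradVec]

theorem gradVec_smul (c : ℝ) (g : Plane →ᵃ[ℝ] ℝ) : gradVec (c • g) = c • gradVec g := by
  simp [gradVec]

/-- A recursion in which every value is determined by the earlier ones has a unique solution. -/
theorem existsUnique_of_eq_history {ι V : Type*} [Preorder ι] [WellFoundedLT ι] [Inhabited V]
    (S : ι → (ι → V) → V) (hS : ∀ n u u', (∀ k < n, u k = u' k) → S n u = S n u') :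
    ∃! u : ι → V, ∀ n, u n = S n u := by
  classical
  let F : (n : ι) → ((k : ι) → k < n → V) → V := fun n rec =>
    -- The default at indices not below `n` is irrelevant, since `S n` sees only earlier values.
    S n fun k => if h : k < n then rec k h else default
  refine ⟨wellFounded_lt.fix F, fun n => ?_, fun u hu => funext fun n => ?_⟩
  · rw [wellFounded_lt.fix_eq]
    exact hS _ _ _ fun k hk => by simp [hk]
  · refine wellFounded_lt.induction (C := fun n => u n = wellFounded_lt.fix F n) n fun n ih => ?_
    rw [hu n, wellFounded_lt.fix_eq]
    exact hS _ _ _ fun k hk => (ih k hk).trans (by simp [hk])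

namespace Triangulation

variable {Ω : Set Plane} (𝒯 : Triangulation Ω)

theorem dualInterp_add (v w : Plane → ℝ) (x : Plane) :
    𝒯.dualInterp (v + w) x = 𝒯.dualInterp v x + 𝒯.dualInterp w x := by
  simp only [dualInterp, Pi.add_apply, add_mul, Finset.sum_add_distrib]

theorem dualInterp_smul (c : ℝ) (v : Plane → ℝ) (x : Plane) :
    𝒯.dualInterp (c • v) x = c * 𝒯.dualInterp v x := by
  simp only [dualInterp, Pi.smul_apply, smul_eq_mul, Finset.mul_sum, mul_assoc]

theorem inner2_dualInterp_add_left (hΩ : IsConvexPolygonalDomain Ω) {ψ φ : Plane → ℝ}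
    (hψ : ContinuousOn ψ (closure Ω)) (hφ : ContinuousOn φ (closure Ω)) (v : Plane → ℝ) :
    inner2 Ω (fun x => ψ x + φ x) (𝒯.dualInterp v) =
      inner2 Ω ψ (𝒯.dualInterp v) + inner2 Ω φ (𝒯.dualInterp v) := by
  simp only [inner2, add_mul]
  exact integral_add ((𝒯.integrableOn_mul_dualInterp hΩ hψ v).mono_set subset_closure)
    ((𝒯.integrableOn_mul_dualInterp hΩ hφ v).mono_set subset_closure)

theorem inner2_const_mul_left (c : ℝ) (ψ φ : Plane → ℝ) :
    inner2 Ω (fun x => c * ψ x) φ = c * inner2 Ω ψ φ := by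
  simp only [inner2, mul_assoc, integral_const_mul]

/-- The functional `v ↦ (ψ, I_h^* v)` on the trial space. -/
def testFunctional (hΩ : IsConvexPolygonalDomain Ω) {ψ : Plane → ℝ}
    (hψ : ContinuousOn ψ (closure Ω)) : Module.Dual ℝ 𝒯.trialSpace where
  toFun v := inner2 Ω ψ (𝒯.dualInterp v)
  map_add' v w := by
    simp only [inner2, Submodule.coe_add, dualInterp_add, mul_add]
    exact integral_add ((𝒯.integrableOn_mul_dualInterp hΩ hψ v).mono_set subset_closure)
      ((𝒯.integrableOn_mul_dualInterp hΩ hψ w).mono_set subset_closure)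
  map_smul' c v := by
    simp only [inner2, Submodule.coe_smul, dualInterp_smul, mul_left_comm _ c, integral_const_mul,
      RingHom.id_apply, smul_eq_mul]

@[simp]
theorem testFunctional_apply (hΩ : IsConvexPolygonalDomain Ω) {ψ : Plane → ℝ}
    (hψ : ContinuousOn ψ (closure Ω)) (v : 𝒯.trialSpace) :
    𝒯.testFunctional hΩ hψ v = inner2 Ω ψ (𝒯.dualInterp v) := rfl

/-- `gradient` is not additive where functions fail to be differentiable, so the fluxes are first
expressed by the constant gradients on the triangle. -/
theorem edgeFlux_add {A : Plane → Matrix (Fin 2) (Fin 2) ℝ} (hA : ContinuousOn A (closure Ω))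
    {u u' : Plane → ℝ} (hu : u ∈ 𝒯.trialSpace) (hu' : u' ∈ 𝒯.trialSpace) {K : Finset Plane}
    (hK : K ∈ 𝒯.triangles) {z z' : Plane} (hz : z ∈ K) (hz' : z' ∈ K) :
    edgeFlux A (u + u') K z z' = edgeFlux A u K z z' + edgeFlux A u' K z z' := by
  obtain ⟨g, hg⟩ := hu.2.2 K hK
  obtain ⟨g', hg'⟩ := hu'.2.2 K hK
  have hsub := 𝒯.convexHull_subset_closure hK
  obtain ⟨b, rfl⟩ := 𝒯.exists_basis hK
  obtain ⟨i, rfl⟩ := mem_basisVertices.mp hz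
  obtain ⟨j, rfl⟩ := mem_basisVertices.mp hz'
  have hgg : Set.EqOn (u + u') (g + g' : Plane →ᵃ[ℝ] ℝ)
      (convexHull ℝ (basisVertices b : Set Plane)) := fun x hx => by simp [hg hx, hg' hx]
  rw [edgeFlux_eq A hgg, edgeFlux_eq A hg, edgeFlux_eq A hg', gradVec_add,
    ← intervalIntegral.integral_add (intervalIntegrable_edge (hA.mono hsub) i j _ _)
      (intervalIntegrable_edge (hA.mono hsub) i j _ _)]
  simp only [WithLp.ofLp_add, Matrix.mulVec_add, add_dotProduct]

theorem edgeFlux_smul (A : Plane → Matrix (Fin 2) (Fin 2) ℝ) (c : ℝ)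
    {u : Plane → ℝ} (hu : u ∈ 𝒯.trialSpace) {K : Finset Plane}
    (hK : K ∈ 𝒯.triangles) {z z' : Plane} (hz : z ∈ K) (hz' : z' ∈ K) :
    edgeFlux A (c • u) K z z' = c * edgeFlux A u K z z' := by
  obtain ⟨g, hg⟩ := hu.2.2 K hK
  obtain ⟨b, rfl⟩ := 𝒯.exists_basis hK
  obtain ⟨i, rfl⟩ := mem_basisVertices.mp hz
  obtain ⟨j, rfl⟩ := mem_basisVertices.mp hz'
  have hgc : Set.EqOn (c • u) (c • g : Plane →ᵃ[ℝ] ℝ)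
      (convexHull ℝ (basisVertices b : Set Plane)) := fun x hx => by simp [hg hx]
  rw [edgeFlux_eq A hgc, edgeFlux_eq A hg, gradVec_smul, ← intervalIntegral.integral_const_mul]
  simp only [WithLp.ofLp_smul, Matrix.mulVec_smul, smul_dotProduct, smul_eq_mul]

/-- The bilinear form of the system matrix on the trial space. -/
def systemBilin (hΩ : IsConvexPolygonalDomain Ω) {A : Plane → Matrix (Fin 2) (Fin 2) ℝ}
    (hA : ContinuousOn A (closure Ω)) {q : Plane → ℝ} (hq : ContinuousOn q (closure Ω))
    (α τ : ℝ) : 𝒯.trialSpace →ₗ[ℝ] Module.Dual ℝ 𝒯.trialSpace :=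
  LinearMap.mk₂ ℝ (fun u v => 𝒯.systemForm A q α τ u v)
    (fun u u' v => by
      classical
      have hq' : ∀ u : 𝒯.trialSpace, ContinuousOn (fun x => q x * (u : Plane → ℝ) x)
          (closure Ω) := fun u => hq.mul u.2.1.continuousOn
      have h1 := 𝒯.inner2_dualInterp_add_left hΩ u.2.1.continuousOn u'.2.1.continuousOn v
      have h2 := 𝒯.inner2_dualInterp_add_left hΩ (hq' u) (hq' u') v
      have h3 : 𝒯.diffusionForm A ((u : Plane → ℝ) + u') (𝒯.dualInterp v) =
          𝒯.diffusionForm A u (𝒯.dualInterp v) + 𝒯.diffusionForm A u' (𝒯.dualInterp v) := by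
        simp only [𝒯.diffusionForm_dualInterp A _ v.2.2.1, ← Finset.sum_add_distrib, ← neg_add]
        refine Finset.sum_congr rfl fun K hK => congrArg Neg.neg (Finset.sum_congr rfl fun z hz =>
          Finset.sum_congr rfl fun z' hz' => ?_)
        rw [𝒯.edgeFlux_add hA u.2 u'.2 hK hz (Finset.mem_of_mem_erase hz'), mul_add]
      simp only [systemForm, Submodule.coe_add, h3, Pi.add_apply, mul_add, h2]
      rw [show ((u : Plane → ℝ) + u') = fun x => (u : Plane → ℝ) x + (u' : Plane → ℝ) x from rfl,
        h1]
      ring)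
    (fun c u v => by
      classical
      have h1 := inner2_const_mul_left (Ω := Ω) c u (𝒯.dualInterp v)
      have h2 := inner2_const_mul_left (Ω := Ω) c (fun x => q x * (u : Plane → ℝ) x)
        (𝒯.dualInterp v)
      have h3 : 𝒯.diffusionForm A (c • (u : Plane → ℝ)) (𝒯.dualInterp v) =
          c * 𝒯.diffusionForm A u (𝒯.dualInterp v) := by
        simp only [𝒯.diffusionForm_dualInterp A _ v.2.2.1, Finset.mul_sum, mul_neg]
        refine Finset.sum_congr rfl fun K hK => congrArg Neg.neg (Finset.sum_congr rfl fun z hz =>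
          Finset.sum_congr rfl fun z' hz' => ?_)
        rw [𝒯.edgeFlux_smul A c u.2 hK hz (Finset.mem_of_mem_erase hz')]
        ring
      simp only [systemForm, Submodule.coe_smul, h3, Pi.smul_apply, smul_eq_mul,
        mul_left_comm _ c, h2]
      rw [show (c • (u : Plane → ℝ)) = fun x => c * (u : Plane → ℝ) x from rfl, h1]
      ring)
    (fun u v v' => by
      have hqu : ContinuousOn (fun x => q x * (u : Plane → ℝ) x) (closure Ω) :=
        hq.mul u.2.1.continuousOn
      have h1 := (𝒯.testFunctional hΩ u.2.1.continuousOn).map_add v v'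
      have h2 := (𝒯.testFunctional hΩ hqu).map_add v v'
      have h3 : 𝒯.diffusionForm A u (𝒯.dualInterp (v + v' : 𝒯.trialSpace)) =
          𝒯.diffusionForm A u (𝒯.dualInterp v) + 𝒯.diffusionForm A u (𝒯.dualInterp v') := by
        simp only [diffusionForm, Submodule.coe_add, dualInterp_add, add_mul,
          Finset.sum_add_distrib, neg_add]
      simp only [testFunctional_apply] at h1 h2
      simp only [systemForm]
      rw [h1, h3, h2]
      ring)
    (fun c u v => by
      have hqu : ContinuousOn (fun x => q x * (u : Plane → ℝ) x) (closure Ω) :=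
        hq.mul u.2.1.continuousOn
      have h1 := (𝒯.testFunctional hΩ u.2.1.continuousOn).map_smul c v
      have h2 := (𝒯.testFunctional hΩ hqu).map_smul c v
      have h3 : 𝒯.diffusionForm A u (𝒯.dualInterp (c • v : 𝒯.trialSpace)) =
          c * 𝒯.diffusionForm A u (𝒯.dualInterp v) := by
        simp only [diffusionForm, Submodule.coe_smul, dualInterp_smul, mul_assoc,
          Finset.mul_sum, mul_neg]
      simp only [testFunctional_apply] at h1 h2
      simp only [systemForm]
      rw [h1, h3, h2]
      simp only [smul_eq_mul]
      ring)

/-- A trial function is determined by its nodal values. -/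
theorem trialSpace_eq_zero {v : Plane → ℝ} (hv : v ∈ 𝒯.trialSpace)
    (h : ∀ z ∈ 𝒯.vertices, v z = 0) : v = 0 := by
  ext x
  by_cases hx : x ∈ Ω
  · have hx' : x ∈ closure Ω := subset_closure hx
    rw [← 𝒯.cover] at hx'
    obtain ⟨K, hK, hxK⟩ := Set.mem_iUnion₂.mp hx'
    obtain ⟨g, hg⟩ := hv.2.2 K hK
    obtain ⟨b, rfl⟩ := 𝒯.exists_basis hK
    have hz : ∀ i, g (b i) = 0 := fun i => by
      rw [← hg (basis_mem_convexHull b i)]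
      exact h _ (𝒯.mem_vertices.mpr ⟨_, hK, mem_basisVertices.mpr ⟨i, rfl⟩⟩)
    rw [hg hxK, affineMap_eq_coord b g x]
    simp [hz]
  · exact hv.2.1 x hx

theorem finiteDimensional_trialSpace : FiniteDimensional ℝ 𝒯.trialSpace := by
  let e : 𝒯.trialSpace →ₗ[ℝ] (𝒯.vertices → ℝ) :=
    { toFun := fun v z => (v : Plane → ℝ) z
      map_add' := fun _ _ => rfl
      map_smul' := fun _ _ => rfl }
  refine FiniteDimensional.of_injective e ((injective_iff_map_eq_zero e).mpr fun v hv => ?_)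
  exact Subtype.ext (𝒯.trialSpace_eq_zero v.2 fun z hz => congrFun hv ⟨z, hz⟩)

/-- Testing a kernel element with itself contradicts positivity; injectivity suffices because the
dual has the same dimension. -/
theorem systemBilin_bijective (hΩ : IsConvexPolygonalDomain Ω)
    {A : Plane → Matrix (Fin 2) (Fin 2) ℝ} (hA : ContinuousOn A (closure Ω)) {q : Plane → ℝ}
    (hq : ContinuousOn q (closure Ω)) {α τ : ℝ}
    (hpos : ∀ w ∈ 𝒯.trialSpace, w ≠ 0 → 0 < 𝒯.systemForm A q α τ w w) :
    Function.Bijective (𝒯.systemBilin hΩ hA hq α τ) := by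
  have := 𝒯.finiteDimensional_trialSpace
  have hinj : Function.Injective (𝒯.systemBilin hΩ hA hq α τ) := by
    refine (injective_iff_map_eq_zero _).mpr fun w hw => ?_
    by_contra hne
    have h1 := hpos w w.2 fun h => hne (Subtype.ext h)
    have h2 : 𝒯.systemForm A q α τ w w = 0 := LinearMap.congr_fun hw w
    linarith
  exact ⟨hinj, (LinearMap.injective_iff_surjective_of_finrank_eq_finrank
    (Subspace.dual_finrank_eq).symm).mp hinj⟩

/-! ### Time stepping -/

/-- The contribution of the earlier time levels to the discrete Caputo derivative. -/
def history (α : ℝ) {N : ℕ} (φ : Fin (N + 1) → Plane → ℝ) (n : Fin (N + 1)) : Plane → ℝ :=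
  fun x => ∑ k ∈ Finset.Iio n, btilde α n k * φ k x

theorem discreteCaputo_eq (α τ : ℝ) {N : ℕ} (φ : Fin (N + 1) → Plane → ℝ) (n : Fin (N + 1)) :
    discreteCaputo α τ φ n =
      fun x => τ ^ (-α) / Real.Gamma (2 - α) * (φ n x + history α φ n x) := by
  ext x
  rw [discreteCaputo, history, ← Finset.Iio_insert, Finset.sum_insert (by simp)]
  simp [btilde]

theorem continuous_history (α : ℝ) {N : ℕ} (u : Fin (N + 1) → 𝒯.trialSpace) (n : Fin (N + 1)) :
    Continuous (history α (fun k => (u k : Plane → ℝ)) n) :=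
  continuous_finsetSum _ fun k _ => (u k).2.1.const_mul _

/-- The weight of the current level is 1, so multiplying by $\tau^\alpha$ and moving the history to
the right leaves exactly the system form. -/
theorem scheme_step_iff (hΩ : IsConvexPolygonalDomain Ω) {A : Plane → Matrix (Fin 2) (Fin 2) ℝ}
    {q : Plane → ℝ} {α τ : ℝ} (hτ : 0 < τ) {N : ℕ}
    (u : Fin (N + 1) → 𝒯.trialSpace) (n : Fin (N + 1)) (φ v : Plane → ℝ) :
    inner2 Ω (discreteCaputo α τ (fun k => (u k : Plane → ℝ)) n) (𝒯.dualInterp v)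
        + 𝒯.diffusionForm A (u n) (𝒯.dualInterp v)
        + inner2 Ω (fun x => q x * (u n : Plane → ℝ) x) (𝒯.dualInterp v)
      = inner2 Ω φ (𝒯.dualInterp v) ↔
    𝒯.systemForm A q α τ (u n) v = τ ^ α * inner2 Ω φ (𝒯.dualInterp v) -
      (Real.Gamma (2 - α))⁻¹ *
        inner2 Ω (history α (fun k => (u k : Plane → ℝ)) n) (𝒯.dualInterp v) := by
  rw [discreteCaputo_eq, inner2_const_mul_left, 𝒯.inner2_dualInterp_add_left hΩ
    (u n).2.1.continuousOn (𝒯.continuous_history α u n).continuousOn, systemForm]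
  have hτα := Real.rpow_pos_of_pos hτ α
  have hc : τ ^ (-α) / Real.Gamma (2 - α) * τ ^ α = (Real.Gamma (2 - α))⁻¹ := by
    rw [Real.rpow_neg hτ.le]
    field_simp
  rw [← mul_right_inj' hτα.ne', ← hc]
  constructor <;> intro h <;> linarith

theorem existsUnique_solvesScheme (hΩ : IsConvexPolygonalDomain Ω)
    {A : Plane → Matrix (Fin 2) (Fin 2) ℝ} (hA : ContinuousOn A (closure Ω)) {q : Plane → ℝ}
    (hq : ContinuousOn q (closure Ω)) {α T : ℝ} (hT : 0 < T) {N : ℕ} (hN : 0 < N)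
    (hpos : ∀ w ∈ 𝒯.trialSpace, w ≠ 0 → 0 < 𝒯.systemForm A q α (T / N) w w)
    {f : Plane → ℝ → ℝ}
    (hf : ContinuousOn (Function.uncurry f) (closure Ω ×ˢ Set.Icc (0 : ℝ) T)) (u₀ : 𝒯.trialSpace) :
    ∃! u : Fin (N + 1) → 𝒯.trialSpace, u 0 = u₀ ∧ 𝒯.SolvesScheme A q f α T N u := by
  have hN' : (0 : ℝ) < N := Nat.cast_pos.mpr hN
  have hτ : 0 < T / N := div_pos hT hN'
  -- Continuity of `f` is known only on $[0,T]$, so $0\le t_n\le T$ must be checked.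
  have hfn : ∀ n : Fin (N + 1),
      ContinuousOn (fun x => f x ((n : ℕ) * (T / N))) (closure Ω) := by
    intro n
    refine hf.comp (f := fun x => (x, (n : ℕ) * (T / N))) (by fun_prop) fun x hx => ⟨hx, ?_, ?_⟩
    · positivity
    · have hn : ((n : ℕ) : ℝ) ≤ N := Nat.cast_le.mpr (Nat.lt_succ_iff.mp n.2)
      calc ((n : ℕ) : ℝ) * (T / N) ≤ N * (T / N) := mul_le_mul_of_nonneg_right hn hτ.le
        _ = T := by field_simp
  let e := Equiv.ofBijective _ (𝒯.systemBilin_bijective hΩ hA hq hpos)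
  let ℓ : Fin (N + 1) → (Fin (N + 1) → 𝒯.trialSpace) → Module.Dual ℝ 𝒯.trialSpace := fun n u =>
    (T / N) ^ α • 𝒯.testFunctional hΩ (hfn n) - (Real.Gamma (2 - α))⁻¹ •
      𝒯.testFunctional hΩ (𝒯.continuous_history α u n).continuousOn
  -- Level 0 returns the initial value; every other level solves the system with the data of earlier
  -- levels.
  let S : Fin (N + 1) → (Fin (N + 1) → 𝒯.trialSpace) → 𝒯.trialSpace := fun n u =>
    if n = 0 then u₀ else e.symm (ℓ n u)
  have hS : ∀ n u u', (∀ k < n, u k = u' k) → S n u = S n u' := by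
    intro n u u' h
    have hh : history α (fun k => (u k : Plane → ℝ)) n =
        history α (fun k => (u' k : Plane → ℝ)) n := by
      ext x
      exact Finset.sum_congr rfl fun k hk => by simp only [h k (Finset.mem_Iio.mp hk)]
    have hℓ : ℓ n u = ℓ n u' := by
      ext v
      simp only [ℓ, testFunctional_apply, LinearMap.sub_apply, LinearMap.smul_apply, hh]
    simp only [S, hℓ]
  refine (existsUnique_congr fun u => ?_).mp (existsUnique_of_eq_history S hS)
  have hstep : ∀ n, n ≠ 0 → (u n = S n u ↔ ∀ v ∈ 𝒯.trialSpace,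
      inner2 Ω (discreteCaputo α (T / N) (fun k => (u k : Plane → ℝ)) n) (𝒯.dualInterp v)
        + 𝒯.diffusionForm A (u n) (𝒯.dualInterp v)
        + inner2 Ω (fun x => q x * (u n : Plane → ℝ) x) (𝒯.dualInterp v)
      = inner2 Ω (fun x => f x ((n : ℕ) * (T / N))) (𝒯.dualInterp v)) := by
    intro n hn
    simp only [S, if_neg hn, Equiv.eq_symm_apply, 𝒯.scheme_step_iff hΩ hτ]
    exact ⟨fun h v hv => LinearMap.congr_fun h ⟨v, hv⟩, fun h => LinearMap.ext fun v => h v v.2⟩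
  constructor
  · exact fun h => ⟨by simpa [S] using h 0, fun n hn => (hstep n hn).mp (h n)⟩
  · rintro ⟨h0, h⟩ n
    by_cases hn : n = 0
    · subst hn; simpa [S] using h0
    · exact (hstep n hn).mpr (h n hn)

end Triangulation

end FVE

end

theorem theorem4p1 (Ω : Set FVE.Plane) (hΩ : FVE.IsConvexPolygonalDomain Ω)
    (A : FVE.Plane → Matrix (Fin 2) (Fin 2) ℝ) (hA : ContinuousOn A (closure Ω))
    (hA_symm : ∀ x ∈ closure Ω, (A x).IsSymm)
    (β₀ : ℝ) (hβ₀ : 0 < β₀)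
    (hA_pos : ∀ x ∈ closure Ω, ∀ ξ : Fin 2 → ℝ, β₀ * (ξ ⬝ᵥ ξ) ≤ ξ ⬝ᵥ (A x *ᵥ ξ))
    (q : FVE.Plane → ℝ) (hq : ContinuousOn q (closure Ω)) (hq_nonneg : ∀ x ∈ closure Ω, 0 ≤ q x)
    (ρ : ℝ) (hρ : 0 < ρ) :
    ∃ h₀ : ℝ, 0 < h₀ ∧
      ∀ 𝒯 : FVE.Triangulation Ω, 𝒯.IsQuasiUniform ρ → 𝒯.meshSize ≤ h₀ →
      ∀ α : ℝ, 0 < α → α < 1 → ∀ T : ℝ, 0 < T → ∀ N : ℕ, 0 < N →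
        (∀ w ∈ 𝒯.trialSpace, w ≠ 0 → 0 < 𝒯.systemForm A q α (T / N) w w) ∧
        ∀ f : FVE.Plane → ℝ → ℝ,
          ContinuousOn (Function.uncurry f) (closure Ω ×ˢ Set.Icc (0 : ℝ) T) →
          ∀ u₀ : 𝒯.trialSpace,
            ∃! u : Fin (N + 1) → 𝒯.trialSpace, u 0 = u₀ ∧ 𝒯.SolvesScheme A q f α T N u := by
  obtain ⟨h₀, hh₀, hpos⟩ := FVE.exists_systemForm_pos hΩ hA hβ₀ hA_pos hq hq_nonneg hρ
  refine ⟨h₀, hh₀, fun 𝒯 h𝒯 hmesh α _ hα T hT N hN => ?_⟩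
  have hw := hpos 𝒯 h𝒯 hmesh α hα (T / N) (div_pos hT (Nat.cast_pos.mpr hN))
  exact ⟨hw, fun f hf u₀ => 𝒯.existsUnique_solvesScheme hΩ hA hq hT hN hw hf u₀⟩
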